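/- Let $q$ be a complex number with $|q|<1$, let $\nu$ be a positive integer and let $M$ be a non-negative integer. For integers $A,B$ let $${A \brack B}_q=\frac{(q;q)_A}{(q;q)_B\,(q;q)_{A-B}}\ \text{ if } B\ge 0 \text{ and } A-B\ge 0,\qquad {A\brack B}_q=0\ \text{ otherwise},$$ where $(a;q)_n=\prod_{k=0}^{n-1}(1-aq^k)$. For non-negative integers $n_1,\dots,n_\nu$ put $N_k=n_k+n_{k+1}+\dots+n_\nu$ for $k=1,\dots,\nu$. Then $$\sum_{\substack{i,m,n_1,\dots,n_\nu\ge 0\\ i+m\equiv N_1+\dots+N_\nu \ (\mathrm{mod}\ 2)}} q^{\frac{m^2+3(i^2+N_1^2+\dots+N_\nu^2)}{2}}{M\brack i}_{q^3}{3n_\nu\brack m}_{q}{2n_\nu+\frac{i-N_1-\dots-N_\nu-m}{2}\brack 2n_\nu}_{q^3}\prod_{j=1}^{\nu-1}{i-\sum_{k=1}^{j}N_k+n_j\brack n_j}_{q^3}$$ $$=\sum_{j=-\infty}^{\infty}q^{3{\nu+2\choose 2}j^2+j}{2M\brack M+(\nu+1)j}_{q^3},$$ where both sums have only finitely many non-zero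 terms. -/

import Mathlib

namespace QSeries

/-- The `q`-Pochhammer symbol `(a; q)_n = (1 - a)(1 - a q) ⋯ (1 - a q^(n-1))`. -/
noncomputable def qPochhammer (a q : ℂ) (n : ℕ) : ℂ :=
  ∏ k ∈ Finset.range n, (1 - a * q ^ k)

/-- The `q`-binomial coefficient with top entry `A` and bottom entry `B` in base `q`:
`(q;q)_A / ((q;q)_B (q;q)_(A-B))` if `B ≥ 0` and `A - B ≥ 0`, and `0` otherwise. -/
noncomputable def qBinomial (q : ℂ) (A B : ℤ) : ℂ :=
  if 0 ≤ B ∧ 0 ≤ A - B then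
    qPochhammer q q A.toNat / (qPochhammer q q B.toNat * qPochhammer q q (A - B).toNat)
  else 0

/-- The tail sum `N_k = n_k + n_{k+1} + ⋯ + n_ν`. The indices `1, …, ν` of the text are the
elements `0, …, ν - 1` of `Fin ν`. -/
def tailSum {ν : ℕ} (n : Fin ν → ℕ) (k : Fin ν) : ℕ :=
  ∑ l ∈ Finset.Ici k, n l

/-- The last entry `n_ν` of `(n_1, …, n_ν)`. -/
def lastEntry {ν : ℕ} (hν : 0 < ν) (n : Fin ν → ℕ) : ℕ :=
  n ⟨ν - 1, Nat.sub_lt hν Nat.one_pos⟩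

/-- The parity condition `i + m ≡ N_1 + ⋯ + N_ν (mod 2)`. -/
def ParityCondition {ν : ℕ} (i m : ℕ) (n : Fin ν → ℕ) : Prop :=
  i + m ≡ ∑ k, tailSum n k [MOD 2]

/-- The summand of the multisum. It is only used under `ParityCondition i m n`, and then both
divisions by `2` are exact. -/
noncomputable def multisumTerm {ν : ℕ} (hν : 0 < ν) (M : ℕ) (q : ℂ)
    (i m : ℕ) (n : Fin ν → ℕ) : ℂ :=
  q ^ ((m ^ 2 + 3 * (i ^ 2 + ∑ k, tailSum n k ^ 2)) / 2)
    * qBinomial (q ^ 3) M i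
    * qBinomial q (3 * lastEntry hν n) m
    * qBinomial (q ^ 3)
        (2 * lastEntry hν n + ((i : ℤ) - ∑ k, (tailSum n k : ℤ) - m) / 2) (2 * lastEntry hν n)
    * ∏ j ∈ Finset.univ.filter (fun j : Fin ν => j.val + 1 < ν),
        qBinomial (q ^ 3) ((i : ℤ) - ∑ k ∈ Finset.Iic j, (tailSum n k : ℤ) + n j) (n j)

/-- The set of all `(i, m, (n_1, …, n_ν))` of non-negative integers satisfying the parity
condition. -/
def multisumIndex (ν : ℕ) : Set (ℕ × ℕ × (Fin ν → ℕ)) :=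
  {p | ParityCondition p.1 p.2.1 p.2.2}

/-- The summand of the single sum on the right, for `j : ℤ`. -/
noncomputable def singleSumTerm (ν M : ℕ) (q : ℂ) (j : ℤ) : ℂ :=
  q ^ (3 * ((ν + 2).choose 2 : ℤ) * j ^ 2 + j)
    * qBinomial (q ^ 3) (2 * M) (M + (ν + 1) * j)

end QSeries

namespace QSeries

open Function Filter Topology

/-! ### Sums with finite support -/

/-! For q ≠ 0, choose s with s² = q and put t = s³, p = q³, so that t² = p and half-integral powers
of q become integral powers of s. Write T(L,M,a,b) for the refined q-trinomial coefficient `trin t p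
L M a b`. The engine is the transformation Σ_i t^(i²) [L+M-i, L]_p T(L-i,i,a,b) = t^(b²)
T(L,M,a+b,b) (`trin_transform`), a threefold use of q-Pfaff–Saalschütz.

Put S_c(L,M) = Σ_b q^b t^(c b²) T(L,M,cb,b). Since the transformation turns a = cb into (c+1)b, one
more summation takes S_c to S_{c+1} (`trinSum_step`). Each additional n_k in the multisum
contributes exactly one such summation. Hence, with i replaced by an integer L and N_1 = N fixed,
the part of the multisum not involving M is t^(N²) S_ν(L-N,N) (`layer_eq`).

The induction starts at S_1 (`trinSum_one`), where Saalschütz reduces the trinomials to products of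
three base-q³ binomials. The sum over b with weight q^b then collapses them to [3M, m]_q, because
(-sX;q)_{3n} splits by exponents mod 3 into three products in base q³ (`cubic_convolution`).

It remains to sum over N_1 and i (`trinSum_total`). The N_1-sum is the limit M → ∞ of the
transformation, and the i-sum is two q-Chu–Vandermonde sums (`finsum_trinLim`), giving [2M,
M+(ν+1)b]. The t-exponents ν b², b² and ((ν+1)b)² add up to (ν+1)(ν+2)b².

For q = 0, where negative powers of q are not available, both sides are 1 by inspection. -/

theorem finsum_comm_of_finite {α β : Type*} (f : α → β → ℂ)
    (h : {x : α × β | f x.1 x.2 ≠ 0}.Finite) :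
    ∑ᶠ a, ∑ᶠ b, f a b = ∑ᶠ b, ∑ᶠ a, f a b := by
  have h1 := finsum_curry (fun x : α × β => f x.1 x.2) h
  have h2 := finsum_curry (fun x : β × α => f x.2 x.1)
    ((h.preimage (Equiv.prodComm β α).injective.injOn).subset fun x hx => hx)
  rw [← h1, ← h2, ← finsum_comp_equiv (Equiv.prodComm β α)]
  rfl

theorem exists_ne_zero_of_finsum {α : Type*} {f : α → ℂ} (h : ∑ᶠ a, f a ≠ 0) : ∃ a, f a ≠ 0 := by
  by_contra! hf
  exact h (finsum_eq_zero_of_forall_eq_zero hf)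

theorem finsum_sub_left (c : ℤ) (f : ℤ → ℂ) : ∑ᶠ n, f (c - n) = ∑ᶠ n, f n :=
  finsum_comp_equiv (Equiv.subLeft c)

theorem finsum_add_right (c : ℤ) (f : ℤ → ℂ) : ∑ᶠ n, f (n + c) = ∑ᶠ n, f n :=
  finsum_comp_equiv (Equiv.addRight c)

theorem finite_of_int_bounds {P : ℤ → Prop} (a b : ℤ) (h : ∀ n, P n → a ≤ n ∧ n ≤ b) :
    {n | P n}.Finite :=
  (Set.finite_Icc a b).subset fun n hn => h n hn

theorem finite_of_int_bounds₂ {P : ℤ × ℤ → Prop} (a b c d : ℤ)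
    (h : ∀ x, P x → a ≤ x.1 ∧ x.1 ≤ b ∧ c ≤ x.2 ∧ x.2 ≤ d) : {x | P x}.Finite :=
  ((Set.finite_Icc a b).prod (Set.finite_Icc c d)).subset fun x hx =>
    ⟨⟨(h x hx).1, (h x hx).2.1⟩, ⟨(h x hx).2.2.1, (h x hx).2.2.2⟩⟩

/-! ### Factorials in base `p` and their reciprocals -/

/-- The `p`-factorial `(p; p)_n`, with value `1` for negative `n`. -/
noncomputable def qFac (p : ℂ) (n : ℤ) : ℂ := qPochhammer p p n.toNat

/-- The reciprocal `1 / (p; p)_n`, with value `0` for negative `n`. -/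
noncomputable def qInvFac (p : ℂ) (n : ℤ) : ℂ := if 0 ≤ n then (qFac p n)⁻¹ else 0

theorem qBinomial_eq (p : ℂ) (A B : ℤ) :
    qBinomial p A B = qFac p A * qInvFac p B * qInvFac p (A - B) := by
  unfold qBinomial qInvFac qFac
  by_cases h1 : 0 ≤ B <;> by_cases h2 : 0 ≤ A - B <;> simp only [h1, h2, and_self, and_false,
    and_true, if_true, if_false, mul_zero, zero_mul]
  rw [div_eq_mul_inv, mul_inv, mul_assoc]

theorem nonneg_of_qInvFac {p : ℂ} {n : ℤ} (h : qInvFac p n ≠ 0) : 0 ≤ n := by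
  by_contra hn
  exact h (by simp [qInvFac, hn])

theorem qInvFac_of_neg {p : ℂ} {n : ℤ} (h : n < 0) : qInvFac p n = 0 := by
  simp [qInvFac, not_le.mpr h]

theorem one_sub_pow_ne_zero {p : ℂ} (hp : ‖p‖ < 1) {n : ℕ} (hn : n ≠ 0) : 1 - p ^ n ≠ 0 := by
  intro h
  have h1 : ‖p ^ n‖ = 1 := by rw [← sub_eq_zero.mp h]; simp
  rw [norm_pow] at h1
  exact absurd h1 (pow_lt_one₀ (norm_nonneg _) hp hn).ne

theorem qFac_ne_zero {p : ℂ} (hp : ‖p‖ < 1) (n : ℤ) : qFac p n ≠ 0 := by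
  unfold qFac qPochhammer
  refine Finset.prod_ne_zero_iff.mpr fun k _ => ?_
  rw [← pow_succ']
  exact one_sub_pow_ne_zero hp k.succ_ne_zero

theorem qFac_mul_qInvFac {p : ℂ} (hp : ‖p‖ < 1) {n : ℤ} (hn : 0 ≤ n) :
    qFac p n * qInvFac p n = 1 := by
  simp [qInvFac, hn, qFac_ne_zero hp]

@[simp] theorem qFac_zero (p : ℂ) : qFac p 0 = 1 := by simp [qFac, qPochhammer]

@[simp] theorem qInvFac_zero (p : ℂ) : qInvFac p 0 = 1 := by simp [qInvFac]

theorem qFac_succ (p : ℂ) {n : ℤ} (hn : 0 ≤ n) :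
    qFac p (n + 1) = (1 - p ^ (n + 1)) * qFac p n := by
  lift n to ℕ using hn
  unfold qFac qPochhammer
  have h1 : ((n : ℤ) + 1).toNat = n + 1 := by omega
  rw [h1, Int.toNat_natCast, Finset.prod_range_succ, mul_comm, ← pow_succ']
  norm_cast

theorem qInvFac_eq_mul {p : ℂ} (hp : ‖p‖ < 1) (n : ℤ) :
    qInvFac p n = (1 - p ^ (n + 1)) * qInvFac p (n + 1) := by
  rcases lt_trichotomy n (-1) with h | rfl | h
  · rw [qInvFac_of_neg (by omega), qInvFac_of_neg (by omega), mul_zero]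
  · simp [qInvFac]
  · have hn : 0 ≤ n := by omega
    have h0 : (1 - p ^ (n + 1)) ≠ 0 := by
      lift n to ℕ using hn
      exact_mod_cast one_sub_pow_ne_zero hp n.succ_ne_zero
    simp only [qInvFac, hn, (by omega : 0 ≤ n + 1), if_true]
    rw [qFac_succ p hn]
    field_simp

theorem qInvFac_pred {p : ℂ} (hp : ‖p‖ < 1) (n : ℤ) :
    qInvFac p (n - 1) = (1 - p ^ n) * qInvFac p n := by
  simpa using qInvFac_eq_mul hp (n - 1)

/-! ### The `q`-Chu–Vandermonde and `q`-Pfaff–Saalschütz sums -/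

/-- The summand of the `q`-Chu–Vandermonde sum. -/
noncomputable def vandTerm (p : ℂ) (x y k n : ℤ) : ℂ :=
  p ^ (n * (n + k)) * qInvFac p n * qInvFac p (n + k) * qInvFac p (x - n) * qInvFac p (y - n)

theorem vandTerm_bounds {p : ℂ} {x y k n : ℤ} (h : vandTerm p x y k n ≠ 0) :
    0 ≤ n ∧ 0 ≤ n + k ∧ n ≤ x ∧ n ≤ y := by
  simp only [vandTerm, ne_eq, mul_eq_zero, not_or] at h
  obtain ⟨⟨⟨⟨-, h1⟩, h2⟩, h3⟩, h4⟩ := h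
  have := nonneg_of_qInvFac h1
  have := nonneg_of_qInvFac h2
  have := nonneg_of_qInvFac h3
  have := nonneg_of_qInvFac h4
  omega

theorem vandTerm_support_finite (p : ℂ) (x y k : ℤ) : (support (vandTerm p x y k)).Finite :=
  finite_of_int_bounds 0 x fun _ hn => ⟨(vandTerm_bounds hn).1, (vandTerm_bounds hn).2.2.1⟩

/-- Termwise, 1 - p^(x+1) = (1 - p^(x+1-n)) + p^(x+1-n) (1 - p^n). The first part lowers x+1 to x;
the second turns 1/(p;p)_n into 1/(p;p)_{n-1}, after which n is shifted by one. -/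
theorem finsum_vandTerm_succ {p : ℂ} (hp : ‖p‖ < 1) (hp0 : p ≠ 0) (x y k : ℤ) :
    (1 - p ^ (x + 1)) * ∑ᶠ n, vandTerm p (x + 1) y k n =
      ∑ᶠ n, vandTerm p x y k n + p ^ (x + k + 1) * ∑ᶠ n, vandTerm p x (y - 1) (k + 1) n := by
  have h1 : ∑ᶠ n, p ^ (x + k + 1) * vandTerm p x (y - 1) (k + 1) n =
      ∑ᶠ n, p ^ (x + k + 1) * vandTerm p x (y - 1) (k + 1) (n - 1) :=
    (finsum_add_right (-1) (fun n => p ^ (x + k + 1) * vandTerm p x (y - 1) (k + 1) n)).symm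
  rw [mul_finsum, mul_finsum, h1, ← finsum_add_distrib (vandTerm_support_finite p x y k)]
  · refine finsum_congr fun n => ?_
    unfold vandTerm
    have e1 : n - 1 + (k + 1) = n + k := by ring
    have e2 : x - (n - 1) = x + 1 - n := by ring
    have e3 : y - 1 - (n - 1) = y - n := by ring
    rw [e1, e2, e3, qInvFac_pred hp n, show x - n = (x + 1 - n) - 1 by ring,
      qInvFac_pred hp (x + 1 - n)]
    have e4 : p ^ (x + 1) = p ^ (x + 1 - n) * p ^ n := by
      rw [← zpow_add₀ hp0]; congr 1; ring
    have e5 : p ^ (x + k + 1) * p ^ ((n - 1) * (n + k)) =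
        p ^ (x + 1 - n) * p ^ (n * (n + k)) := by
      rw [← zpow_add₀ hp0, ← zpow_add₀ hp0]; congr 1; ring
    rw [e4]
    linear_combination (-(1 - p ^ n) * qInvFac p n * qInvFac p (n + k) * qInvFac p (x + 1 - n) *
      qInvFac p (y - n)) * e5
  · refine (((vandTerm_support_finite p x (y - 1) (k + 1)).preimage
      (sub_left_injective (b := (1 : ℤ))).injOn)).subset fun n hn => ?_
    exact right_ne_zero_of_mul hn

theorem vandermonde {p : ℂ} (hp : ‖p‖ < 1) (hp0 : p ≠ 0) (x y k : ℤ) :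
    ∑ᶠ n, vandTerm p x y k n = qFac p (x + y + k) * qInvFac p x * qInvFac p y *
      qInvFac p (x + k) * qInvFac p (y + k) := by
  rcases lt_or_ge x 0 with hx | hx
  · rw [qInvFac_of_neg hx, finsum_eq_zero_of_forall_eq_zero]
    · ring
    · intro n
      by_contra h
      have := vandTerm_bounds h
      omega
  lift x to ℕ using hx
  induction x generalizing y k with
  | zero =>
    rw [finsum_eq_single _ 0]
    · simp only [vandTerm]
      simp only [Nat.cast_zero, zero_mul, zpow_zero, zero_add, sub_zero, qInvFac_zero]
      by_cases h : 0 ≤ y ∧ 0 ≤ k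
      · linear_combination (-(qInvFac p y) * qInvFac p k) *
          qFac_mul_qInvFac hp (n := y + k) (by omega)
      · rw [not_and_or, not_le, not_le] at h
        rcases h with h | h <;> simp [qInvFac_of_neg h]
    · intro n hn
      by_contra h
      have := vandTerm_bounds h
      omega
  | succ x ih =>
    have h := finsum_vandTerm_succ hp hp0 x y k
    rw [ih, ih] at h
    have h0 : (1 - p ^ ((x : ℤ) + 1)) ≠ 0 := by
      exact_mod_cast one_sub_pow_ne_zero hp x.succ_ne_zero
    push_cast
    refine mul_left_cancel₀ h0 (h.trans ?_)
    have e1 : (x : ℤ) + (y - 1) + (k + 1) = x + y + k := by ring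
    have e2 : y - 1 + (k + 1) = y + k := by ring
    have e3 : (x : ℤ) + (k + 1) = x + k + 1 := by ring
    have e4 : (x : ℤ) + 1 + k = x + k + 1 := by ring
    have e5 : (x : ℤ) + 1 + y + k = x + y + k + 1 := by ring
    rw [e1, e2, e3, e4, e5, qInvFac_eq_mul hp (x : ℤ), qInvFac_eq_mul hp ((x : ℤ) + k),
      qInvFac_pred hp y]
    -- `qFac` is 1 at negative arguments, so its recursion needs x + y + k ≥ 0. When one of these
    -- bounds fails, a vanishing reciprocal kills both sides.
    by_cases hc : 0 ≤ y ∧ 0 ≤ (x : ℤ) + k + 1 ∧ 0 ≤ y + k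
    · have hxy : 0 ≤ (x : ℤ) + y + k := by omega
      have e6 : p ^ ((x : ℤ) + y + k + 1) = p ^ ((x : ℤ) + k + 1) * p ^ y := by
        rw [← zpow_add₀ hp0]; congr 1; ring
      rw [qFac_succ p hxy, e6]
      ring
    · rw [not_and_or, not_and_or, not_le, not_le, not_le] at hc
      rcases hc with h | h | h <;> simp [qInvFac_of_neg h]

/-- The summand of the `q`-Pfaff–Saalschütz sum. -/
noncomputable def saalTerm (p : ℂ) (x y z k n : ℤ) : ℂ :=
  p ^ (n * (n + k)) * qFac p (x + y + z + k - n) * qInvFac p n * qInvFac p (n + k) *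
    qInvFac p (x - n) * qInvFac p (y - n) * qInvFac p (z - n)

theorem saalTerm_bounds {p : ℂ} {x y z k n : ℤ} (h : saalTerm p x y z k n ≠ 0) :
    0 ≤ n ∧ 0 ≤ n + k ∧ n ≤ x ∧ n ≤ y ∧ n ≤ z := by
  simp only [saalTerm, ne_eq, mul_eq_zero, not_or] at h
  obtain ⟨⟨⟨⟨⟨-, h1⟩, h2⟩, h3⟩, h4⟩, h5⟩ := h
  have := nonneg_of_qInvFac h1
  have := nonneg_of_qInvFac h2
  have := nonneg_of_qInvFac h3
  have := nonneg_of_qInvFac h4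
  have := nonneg_of_qInvFac h5
  omega

/-- Three Vandermonde sums: one read backwards introduces a sum over l, and after the interchange
the n-sum and then the l-sum are again of Vandermonde type. -/
theorem saalschutz {p : ℂ} (hp : ‖p‖ < 1) (hp0 : p ≠ 0) (x y z k : ℤ) :
    ∑ᶠ n, saalTerm p x y z k n =
      qFac p (x + y + k) * qFac p (x + z + k) * qFac p (y + z + k) *
        qInvFac p x * qInvFac p y * qInvFac p z *
        qInvFac p (x + k) * qInvFac p (y + k) * qInvFac p (z + k) := by
  by_cases hc : 0 ≤ x ∧ 0 ≤ y ∧ 0 ≤ z ∧ 0 ≤ x + k ∧ 0 ≤ y + k ∧ 0 ≤ z + k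
  swap
  · rw [finsum_eq_zero_of_forall_eq_zero]
    · simp only [not_and_or, not_le] at hc
      rcases hc with h | h | h | h | h | h <;> simp [qInvFac_of_neg h]
    · intro n
      by_contra h
      have := saalTerm_bounds h
      omega
  obtain ⟨hx, hy, hz, hxk, hyk, hzk⟩ := hc
  have hA := qFac_mul_qInvFac hp (n := x + y + k) (by omega)
  have hB := qFac_mul_qInvFac hp (n := y + z + k) (by omega)
  have key : ∀ n, saalTerm p x y z k n = qFac p (x + y + k) * qFac p (y + z + k) *
      ∑ᶠ l, p ^ (l * (l + k)) * qInvFac p (y + k + l) * qInvFac p (x - l) * qInvFac p (z - l) *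
        (p ^ ((y - n) * (l - n)) * qInvFac p n * qInvFac p (n + k) *
          qInvFac p (y - n) * qInvFac p (l - n)) := by
    intro n
    have h := vandermonde hp hp0 (x - n) (z - n) (y + k + n)
    rw [← finsum_add_right (-n)] at h
    have e1 : x - n + (z - n) + (y + k + n) = x + y + z + k - n := by ring
    have e2 : x - n + (y + k + n) = x + y + k := by ring
    have e3 : z - n + (y + k + n) = y + z + k := by ring
    rw [e1, e2, e3] at h
    have h2 : ∑ᶠ l, p ^ (l * (l + k)) * qInvFac p (y + k + l) * qInvFac p (x - l) *
        qInvFac p (z - l) * (p ^ ((y - n) * (l - n)) * qInvFac p n * qInvFac p (n + k) *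
          qInvFac p (y - n) * qInvFac p (l - n)) =
        p ^ (n * (n + k)) * qInvFac p n * qInvFac p (n + k) * qInvFac p (y - n) *
          ∑ᶠ l, vandTerm p (x - n) (z - n) (y + k + n) (l + -n) := by
      rw [mul_finsum]
      refine finsum_congr fun l => ?_
      unfold vandTerm
      have e4 : l + -n + (y + k + n) = y + k + l := by ring
      have e5 : x - n - (l + -n) = x - l := by ring
      have e6 : z - n - (l + -n) = z - l := by ring
      have e7 : l + -n = l - n := by ring
      rw [e4, e5, e6, e7]
      have e8 : p ^ (l * (l + k)) * p ^ ((y - n) * (l - n)) =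
          p ^ (n * (n + k)) * p ^ ((l - n) * (y + k + l)) := by
        rw [← zpow_add₀ hp0, ← zpow_add₀ hp0]; congr 1; ring
      linear_combination (qInvFac p (y + k + l) * qInvFac p (x - l) * qInvFac p (z - l) *
        qInvFac p n * qInvFac p (n + k) * qInvFac p (y - n) * qInvFac p (l - n)) * e8
    rw [h2, h]
    unfold saalTerm
    linear_combination (-(p ^ (n * (n + k)) * qFac p (x + y + z + k - n) * qInvFac p n *
      qInvFac p (n + k) * qInvFac p (x - n) * qInvFac p (y - n) * qInvFac p (z - n))) *
      (hA * (qFac p (y + z + k) * qInvFac p (y + z + k)) + hB)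
  simp_rw [key]
  rw [← mul_finsum, finsum_comm_of_finite]
  swap
  · refine finite_of_int_bounds₂ 0 y 0 x fun n h => ?_
    simp only [ne_eq, mul_eq_zero, not_or] at h
    obtain ⟨⟨⟨-, h1⟩, h2⟩, ⟨⟨⟨-, h3⟩, h4⟩, h5⟩, h6⟩ := h
    have := nonneg_of_qInvFac h1
    have := nonneg_of_qInvFac h3
    have := nonneg_of_qInvFac h5
    have := nonneg_of_qInvFac h6
    omega
  have inner : ∀ l, ∑ᶠ n, p ^ (l * (l + k)) * qInvFac p (y + k + l) * qInvFac p (x - l) *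
        qInvFac p (z - l) * (p ^ ((y - n) * (l - n)) * qInvFac p n * qInvFac p (n + k) *
          qInvFac p (y - n) * qInvFac p (l - n)) =
      qInvFac p y * qInvFac p (y + k) * vandTerm p x z k l := by
    intro l
    rw [← mul_finsum, ← finsum_sub_left y]
    have h := vandermonde hp hp0 y (y + k) (l - y)
    have h2 : ∑ᶠ n, p ^ ((y - (y - n)) * (l - (y - n))) * qInvFac p (y - n) *
        qInvFac p (y - n + k) * qInvFac p (y - (y - n)) * qInvFac p (l - (y - n)) =
        ∑ᶠ n, vandTerm p y (y + k) (l - y) n := by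
      refine finsum_congr fun n => ?_
      unfold vandTerm
      have e1 : y - (y - n) = n := by ring
      have e2 : l - (y - n) = n + (l - y) := by ring
      have e3 : y - n + k = y + k - n := by ring
      rw [e1, e2, e3]
      ring
    rw [h2, h]
    have e1 : y + (y + k) + (l - y) = y + k + l := by ring
    have e2 : y + (l - y) = l := by ring
    have e3 : y + k + (l - y) = l + k := by ring
    rw [e1, e2, e3]
    unfold vandTerm
    by_cases hl : 0 ≤ l
    · linear_combination (p ^ (l * (l + k)) * qInvFac p (x - l) * qInvFac p (z - l) *
        qInvFac p y * qInvFac p (y + k) * qInvFac p l * qInvFac p (l + k)) *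
        qFac_mul_qInvFac hp (n := y + k + l) (by omega)
    · rw [qInvFac_of_neg (not_le.mp hl)]
      ring
  simp_rw [inner]
  rw [← mul_finsum, vandermonde hp hp0]
  ring

/-! ### Refined trinomial coefficients -/

theorem zpow_of_sq {t p : ℂ} (ht : t ^ 2 = p) (e : ℤ) : p ^ e = t ^ (2 * e) := by
  rw [← ht, zpow_mul]; norm_cast

/-- The summand of the refined `q`-trinomial coefficient. -/
noncomputable def trinTerm (t p : ℂ) (L M a b u : ℤ) : ℂ :=
  t ^ ((L - a - 2 * u) ^ 2) *
    (qFac p M * qInvFac p (L - a - 2 * u) * qInvFac p (M - (L - a - 2 * u))) *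
    (qFac p (M + b + u) * qInvFac p (M + b) * qInvFac p u) *
    (qFac p (M - b + a + u) * qInvFac p (M - b) * qInvFac p (u + a))

/-- The refined `q`-trinomial coefficient in base `p = t ^ 2`. -/
noncomputable def trin (t p : ℂ) (L M a b : ℤ) : ℂ := ∑ᶠ u, trinTerm t p L M a b u

theorem trinTerm_bounds {t p : ℂ} {L M a b u : ℤ} (h : trinTerm t p L M a b u ≠ 0) :
    0 ≤ u ∧ 0 ≤ u + a ∧ 0 ≤ L - a - 2 * u ∧ L - a - 2 * u ≤ M ∧ 0 ≤ M + b ∧ 0 ≤ M - b := by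
  simp only [trinTerm, ne_eq, mul_eq_zero, not_or] at h
  obtain ⟨⟨⟨-, ⟨-, h1⟩, h2⟩, ⟨-, h3⟩, h4⟩, ⟨-, h5⟩, h6⟩ := h
  have := nonneg_of_qInvFac h1
  have := nonneg_of_qInvFac h2
  have := nonneg_of_qInvFac h3
  have := nonneg_of_qInvFac h4
  have := nonneg_of_qInvFac h5
  have := nonneg_of_qInvFac h6
  omega

/-- The shift of u by a exchanges the last two binomial factors. -/
theorem trin_neg_neg (t p : ℂ) (L M a b : ℤ) : trin t p L M (-a) (-b) = trin t p L M a b := by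
  unfold trin
  rw [← finsum_add_right a]
  refine finsum_congr fun u => ?_
  unfold trinTerm
  have e1 : L - -a - 2 * (u + a) = L - a - 2 * u := by ring
  have e2 : M + -b + (u + a) = M - b + a + u := by ring
  have e3 : M - -b + -a + (u + a) = M + b + u := by ring
  have e4 : M + -b = M - b := by ring
  have e5 : M - -b = M + b := by ring
  have e6 : u + a + -a = u := by ring
  rw [e1, e2, e3, e4, e5, e6]
  ring

/-- An expansion of a product of three factorial quotients, by the `q`-Pfaff–Saalschütz sum. -/
theorem saalschutz_expansion {p : ℂ} (hp : ‖p‖ < 1) (hp0 : p ≠ 0) {b s : ℤ} (hb : 0 ≤ b)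
    (hs : b ≤ s) (n k : ℤ) :
    qFac p (n + k) * qInvFac p n * qInvFac p k * qInvFac p (n + k - b) * qInvFac p (s - n) *
        qFac p (s + k - b) =
      qFac p b * qFac p (s - b) * qInvFac p s *
        ∑ᶠ j, p ^ ((b - j) * (n - j)) * qFac p (k + s - b + j) * qInvFac p (b - j) *
          qInvFac p (n - j) * qInvFac p j * qInvFac p (k - b + j) * qInvFac p (s - n - b + j) := by
  have h := saalschutz hp hp0 b k (s - n) (n - b)
  rw [← finsum_sub_left b] at h
  have h2 : ∀ j, saalTerm p b k (s - n) (n - b) (b - j) = p ^ ((b - j) * (n - j)) *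
      qFac p (k + s - b + j) * qInvFac p (b - j) *
      qInvFac p (n - j) * qInvFac p j * qInvFac p (k - b + j) * qInvFac p (s - n - b + j) := by
    intro j
    unfold saalTerm
    have e1 : b - j + (n - b) = n - j := by ring
    have e2 : b + k + (s - n) + (n - b) - (b - j) = k + s - b + j := by ring
    have e3 : b - (b - j) = j := by ring
    have e4 : k - (b - j) = k - b + j := by ring
    have e5 : s - n - (b - j) = s - n - b + j := by ring
    rw [e1, e2, e3, e4, e5]
  simp_rw [h2] at h
  rw [h]
  have e1 : b + k + (n - b) = n + k := by ring
  have e2 : b + (s - n) + (n - b) = s := by ring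
  have e3 : k + (s - n) + (n - b) = s + k - b := by ring
  have e4 : b + (n - b) = n := by ring
  have e5 : k + (n - b) = n + k - b := by ring
  have e6 : s - n + (n - b) = s - b := by ring
  rw [e1, e2, e3, e4, e5, e6]
  linear_combination (-(qFac p (n + k) * qInvFac p n * qInvFac p k * qInvFac p (n + k - b) *
    qInvFac p (s - n) * qFac p (s + k - b))) * (
      qFac_mul_qInvFac hp (n := b) hb * qFac p (s - b) * qInvFac p (s - b) *
        (qFac p s * qInvFac p s) +
      qFac_mul_qInvFac hp (n := s - b) (by omega) * (qFac p s * qInvFac p s) +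
      qFac_mul_qInvFac hp (n := s) (by omega))

/-- The summand of the left-hand side of the trinomial transformation, with `k = L - a - 2 w`. -/
noncomputable def transTerm (t p : ℂ) (M a b w k n : ℤ) : ℂ :=
  t ^ ((n + k) ^ 2 + n ^ 2) *
    (qFac p (a + k + 2 * w + M - n - k) * qInvFac p (a + k + 2 * w) * qInvFac p (M - n - k)) *
    (qFac p (n + k) * qInvFac p n * qInvFac p k) *
    (qFac p (w + k + b) * qInvFac p (n + k + b) * qInvFac p (w - n)) *
    (qFac p (w + a + k - b) * qInvFac p (n + k - b) * qInvFac p (w + a - n))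

/-- The intermediate summand in the trinomial transformation. -/
noncomputable def midTerm (t p : ℂ) (M a b w k j : ℤ) : ℂ :=
  t ^ ((k + j) ^ 2 + j ^ 2) * qFac p (M + w + b - j) * qFac p (M + w + a) *
    qInvFac p (M - k - j) * qInvFac p (w - j) * qInvFac p (M + b) * qInvFac p (w + a + k + j) *
    qFac p b * qInvFac p (w + a) * qFac p (k + w + a - b + j) * qInvFac p (b - j) *
    qInvFac p j * qInvFac p (k - b + j)

/-- `saalschutz_expansion` replaces part of the summand by a sum over j; after this the n-sum is
itself Saalschützian and can be carried out, leaving only j. -/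
theorem finsum_transTerm {t p : ℂ} (ht : t ^ 2 = p) (hp : ‖p‖ < 1) (hp0 : p ≠ 0) {a b : ℤ}
    (hb : 0 ≤ b) (hab : b ≤ a) (M w k : ℤ) :
    ∑ᶠ n, transTerm t p M a b w k n = ∑ᶠ j, midTerm t p M a b w k j := by
  have ht0 : t ≠ 0 := by rintro rfl; apply hp0; rw [← ht]; simp
  -- The expansion needs b ≤ w + a, which follows from b ≤ a only when w ≥ 0. For w < 0 both sides
  -- vanish.
  rcases lt_or_ge w 0 with hw | hw
  · rw [finsum_eq_zero_of_forall_eq_zero, finsum_eq_zero_of_forall_eq_zero]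
    · intro j
      unfold midTerm
      rcases lt_or_ge j 0 with h | h
      · simp [qInvFac_of_neg h]
      · simp [qInvFac_of_neg (show w - j < 0 by omega)]
    · intro j
      unfold transTerm
      rcases lt_or_ge j 0 with h | h
      · simp [qInvFac_of_neg h]
      · simp [qInvFac_of_neg (show w - j < 0 by omega)]
  have hX : ∀ n, transTerm t p M a b w k n = ∑ᶠ j, t ^ ((n + k) ^ 2 + n ^ 2) *
      (qFac p (a + k + 2 * w + M - n - k) * qInvFac p (a + k + 2 * w) * qInvFac p (M - n - k)) *
      (qFac p (w + k + b) * qInvFac p (n + k + b) * qInvFac p (w - n)) *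
      (qFac p b * qFac p (w + a - b) * qInvFac p (w + a)) *
      (p ^ ((b - j) * (n - j)) * qFac p (k + (w + a) - b + j) * qInvFac p (b - j) *
        qInvFac p (n - j) * qInvFac p j * qInvFac p (k - b + j) *
        qInvFac p (w + a - n - b + j)) := by
    intro n
    have h := saalschutz_expansion hp hp0 hb (s := w + a) (by omega) n k
    rw [← mul_finsum]
    unfold transTerm
    linear_combination (t ^ ((n + k) ^ 2 + n ^ 2) *
      (qFac p (a + k + 2 * w + M - n - k) * qInvFac p (a + k + 2 * w) * qInvFac p (M - n - k)) *
      (qFac p (w + k + b) * qInvFac p (n + k + b) * qInvFac p (w - n))) * h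
  simp_rw [hX]
  rw [finsum_comm_of_finite]
  swap
  · refine finite_of_int_bounds₂ 0 w 0 b fun n h => ?_
    simp only [ne_eq, mul_eq_zero, not_or] at h
    obtain ⟨⟨⟨⟨-, -⟩, ⟨-, -⟩, h1⟩, -⟩, ⟨⟨⟨⟨-, h2⟩, h3⟩, h4⟩, -⟩, -⟩ := h
    have := nonneg_of_qInvFac h1
    have := nonneg_of_qInvFac h2
    have := nonneg_of_qInvFac h3
    have := nonneg_of_qInvFac h4
    omega
  refine finsum_congr fun j => ?_
  rw [← finsum_add_right j]
  have h := saalschutz hp hp0 (M - k - j) (w - j) (w + a - b) (j + k + b)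
  have hY : ∀ n, t ^ ((n + j + k) ^ 2 + (n + j) ^ 2) *
      (qFac p (a + k + 2 * w + M - (n + j) - k) * qInvFac p (a + k + 2 * w) *
        qInvFac p (M - (n + j) - k)) *
      (qFac p (w + k + b) * qInvFac p (n + j + k + b) * qInvFac p (w - (n + j))) *
      (qFac p b * qFac p (w + a - b) * qInvFac p (w + a)) *
      (p ^ ((b - j) * (n + j - j)) * qFac p (k + (w + a) - b + j) * qInvFac p (b - j) *
        qInvFac p (n + j - j) * qInvFac p j * qInvFac p (k - b + j) *
        qInvFac p (w + a - (n + j) - b + j)) =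
      (t ^ ((k + j) ^ 2 + j ^ 2) * qInvFac p (a + k + 2 * w) * qFac p (w + k + b) *
        (qFac p b * qFac p (w + a - b) * qInvFac p (w + a)) * qFac p (k + w + a - b + j) *
        qInvFac p (b - j) * qInvFac p j * qInvFac p (k - b + j)) *
      saalTerm p (M - k - j) (w - j) (w + a - b) (j + k + b) n := by
    intro n
    unfold saalTerm
    have e1 : a + k + 2 * w + M - (n + j) - k =
      M - k - j + (w - j) + (w + a - b) + (j + k + b) - n := by ring
    have e2 : M - (n + j) - k = M - k - j - n := by ring
    have e3 : n + j + k + b = n + (j + k + b) := by ring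
    have e4 : w - (n + j) = w - j - n := by ring
    have e5 : n + j - j = n := by ring
    have e6 : w + a - (n + j) - b + j = w + a - b - n := by ring
    have e7 : k + (w + a) - b + j = k + w + a - b + j := by ring
    have e8 : t ^ ((n + j + k) ^ 2 + (n + j) ^ 2) * p ^ ((b - j) * n) =
        t ^ ((k + j) ^ 2 + j ^ 2) * p ^ (n * (n + (j + k + b))) := by
      rw [zpow_of_sq ht, zpow_of_sq ht, ← zpow_add₀ ht0, ← zpow_add₀ ht0]; congr 1; ring
    rw [e1, e2, e3, e4, e5, e6, e7]
    linear_combination (qFac p (M - k - j + (w - j) + (w + a - b) + (j + k + b) - n) *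
      qInvFac p (a + k + 2 * w) * qInvFac p (M - k - j - n) *
      (qFac p (w + k + b) * qInvFac p (n + (j + k + b)) * qInvFac p (w - j - n)) *
      (qFac p b * qFac p (w + a - b) * qInvFac p (w + a)) *
      (qFac p (k + w + a - b + j) * qInvFac p (b - j) *
        qInvFac p n * qInvFac p j * qInvFac p (k - b + j) *
        qInvFac p (w + a - b - n))) * e8
  simp_rw [hY]
  rw [← mul_finsum, h]
  unfold midTerm
  have e1 : M - k - j + (w - j) + (j + k + b) = M + w + b - j := by ring
  have e2 : M - k - j + (w + a - b) + (j + k + b) = M + w + a := by ring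
  have e3 : w - j + (w + a - b) + (j + k + b) = a + k + 2 * w := by ring
  have e4 : M - k - j + (j + k + b) = M + b := by ring
  have e5 : w - j + (j + k + b) = w + k + b := by ring
  have e6 : w + a - b + (j + k + b) = w + a + k + j := by ring
  rw [e1, e2, e3, e4, e5, e6]
  by_cases hk : 0 ≤ b - j ∧ 0 ≤ k - b + j
  · have f1 := qFac_mul_qInvFac hp (n := a + k + 2 * w) (by omega)
    have f2 := qFac_mul_qInvFac hp (n := w + k + b) (by omega)
    have f3 := qFac_mul_qInvFac hp (n := w + a - b) (by omega)
    linear_combination (t ^ ((k + j) ^ 2 + j ^ 2) * qFac p (M + w + b - j) *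
      qFac p (M + w + a) * qInvFac p (M - k - j) * qInvFac p (w - j) * qInvFac p (M + b) *
      qInvFac p (w + a + k + j) * qFac p b * qInvFac p (w + a) * qFac p (k + w + a - b + j) *
      qInvFac p (b - j) * qInvFac p j * qInvFac p (k - b + j)) *
      (f1 * (qFac p (w + k + b) * qInvFac p (w + k + b)) *
        (qFac p (w + a - b) * qInvFac p (w + a - b)) +
        f2 * (qFac p (w + a - b) * qInvFac p (w + a - b)) + f3)
  · rw [not_and_or, not_le, not_le] at hk
    rcases hk with h | h <;> simp [qInvFac_of_neg h]

/-- With w = u + j, the sum over j is Saalschützian in the reversed variable b - j. -/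
theorem finsum_midTerm {t p : ℂ} (ht : t ^ 2 = p) (hp : ‖p‖ < 1) (hp0 : p ≠ 0) {a b : ℤ}
    (hb : 0 ≤ b) (hab : b ≤ a) (L M u : ℤ) :
    ∑ᶠ j, midTerm t p M a b (u + j) (L - a - 2 * (u + j)) j =
      t ^ (b ^ 2) * trinTerm t p L M (a + b) b u := by
  have ht0 : t ≠ 0 := by rintro rfl; apply hp0; rw [← ht]; simp
  obtain ⟨n, rfl⟩ : ∃ n, L = n + (a + b) + 2 * u := ⟨L - (a + b) - 2 * u, by ring⟩
  have h := saalschutz hp hp0 b (u + a + b) (M - n) (n - b)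
  rw [← finsum_sub_left b]
  have hZ : ∀ j, midTerm t p M a b (u + (b - j))
      (n + (a + b) + 2 * u - a - 2 * (u + (b - j))) (b - j) =
      (t ^ (b ^ 2) * t ^ (n ^ 2) * qFac p (M + u + b) * qInvFac p u * qInvFac p (M + b) *
        qInvFac p (u + a + n + b) * qFac p b * qFac p (n + u + a)) *
      saalTerm p b (u + a + b) (M - n) (n - b) j := by
    intro j
    unfold midTerm saalTerm
    have e0 : n + (a + b) + 2 * u - a - 2 * (u + (b - j)) = n - b + 2 * j := by ring
    rw [e0]
    have e1 : M + (u + (b - j)) + b - (b - j) = M + u + b := by ring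
    have e2 : M + (u + (b - j)) + a = b + (u + a + b) + (M - n) + (n - b) - j := by ring
    have e3 : M - (n - b + 2 * j) - (b - j) = M - n - j := by ring
    have e4 : u + (b - j) - (b - j) = u := by ring
    have e5 : u + (b - j) + a + (n - b + 2 * j) + (b - j) = u + a + n + b := by ring
    have e6 : u + (b - j) + a = u + a + b - j := by ring
    have e7 : n - b + 2 * j + (u + (b - j)) + a - b + (b - j) = n + u + a := by ring
    have e8 : b - (b - j) = j := by ring
    have e9 : n - b + 2 * j - b + (b - j) = j + (n - b) := by ring
    have e10 : t ^ ((n - b + 2 * j + (b - j)) ^ 2 + (b - j) ^ 2) =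
        t ^ (b ^ 2) * t ^ (n ^ 2) * p ^ (j * (j + (n - b))) := by
      rw [zpow_of_sq ht, ← zpow_add₀ ht0, ← zpow_add₀ ht0]; congr 1; ring
    rw [e1, e2, e3, e4, e5, e6, e7, e8, e9, e10]
    ring
  simp_rw [hZ]
  rw [← mul_finsum, h]
  unfold trinTerm
  have e0 : n + (a + b) + 2 * u - (a + b) - 2 * u = n := by ring
  have e1 : b + (u + a + b) + (n - b) = u + a + n + b := by ring
  have e2 : b + (M - n) + (n - b) = M := by ring
  have e3 : u + a + b + (M - n) + (n - b) = M - b + (a + b) + u := by ring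
  have e4 : b + (n - b) = n := by ring
  have e5 : u + a + b + (n - b) = n + u + a := by ring
  have e6 : M - n + (n - b) = M - b := by ring
  have e7 : M + u + b = M + b + u := by ring
  have e8 : u + (a + b) = u + a + b := by ring
  rw [e0, e1, e2, e3, e4, e5, e6, e7, e8]
  by_cases hk : 0 ≤ n ∧ 0 ≤ u
  · have f1 := qFac_mul_qInvFac hp (n := u + a + n + b) (by omega)
    have f2 := qFac_mul_qInvFac hp (n := b) (by omega)
    have f3 := qFac_mul_qInvFac hp (n := n + u + a) (by omega)
    linear_combination (t ^ (b ^ 2) * t ^ (n ^ 2) * qFac p (M + b + u) * qInvFac p u *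
      qInvFac p (M + b) * qFac p M * qFac p (M - b + (a + b) + u) * qInvFac p (u + a + b) *
      qInvFac p (M - n) * qInvFac p n * qInvFac p (M - b)) *
      (f1 * (qFac p b * qInvFac p b) * (qFac p (n + u + a) * qInvFac p (n + u + a)) +
      f2 * (qFac p (n + u + a) * qInvFac p (n + u + a)) + f3)
  · rw [not_and_or, not_le, not_le] at hk
    rcases hk with h | h <;> simp [qInvFac_of_neg h]

/-- The transformation formula for refined trinomial coefficients. -/
theorem trin_transform {t p : ℂ} (ht : t ^ 2 = p) (hp : ‖p‖ < 1) (hp0 : p ≠ 0) {a b : ℤ}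
    (hb : 0 ≤ b) (hab : b ≤ a) (L M : ℤ) :
    ∑ᶠ i : ℤ, t ^ (i ^ 2) * qBinomial p (L + M - i) L * trin t p (L - i) i a b =
      t ^ (b ^ 2) * trin t p L M (a + b) b := by
  have ht0 : t ≠ 0 := by rintro rfl; apply hp0; rw [← ht]; simp
  -- The reflected variable w = L - a - i - u makes k = L - a - 2w independent of i, so that for
  -- fixed w the i-sum becomes the n-sum of `transTerm` with i = n + k.
  have h1 : ∀ i : ℤ, t ^ (i ^ 2) * qBinomial p (L + M - i) L * trin t p (L - i) i a b =
      ∑ᶠ w, t ^ (i ^ 2) * qBinomial p (L + M - i) L *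
        trinTerm t p (L - i) i a b (L - a - i - w) := by
    intro i
    rw [trin, ← mul_finsum, finsum_sub_left (L - a - i)]
  simp_rw [h1]
  rw [finsum_comm_of_finite]
  swap
  · refine finite_of_int_bounds₂ 0 L 0 L fun x h => ?_
    have h3 := trinTerm_bounds (right_ne_zero_of_mul h)
    omega
  have h2 : ∀ w, ∑ᶠ i : ℤ, t ^ (i ^ 2) * qBinomial p (L + M - i) L *
        trinTerm t p (L - i) i a b (L - a - i - w) =
      ∑ᶠ j, midTerm t p M a b w (L - a - 2 * w) j := by
    intro w
    rw [← finsum_transTerm ht hp hp0 hb hab, ← finsum_add_right (L - a - 2 * w)]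
    refine finsum_congr fun n => ?_
    obtain ⟨k, rfl⟩ : ∃ k, L = a + k + 2 * w := ⟨L - a - 2 * w, by ring⟩
    have e0 : a + k + 2 * w - a - 2 * w = k := by ring
    unfold trinTerm transTerm
    rw [qBinomial_eq, e0]
    have e1 : a + k + 2 * w + M - (n + k) = a + k + 2 * w + M - n - k := by ring
    have e2 : a + k + 2 * w + M - n - k - (a + k + 2 * w) = M - n - k := by ring
    have e3 : a + k + 2 * w - (n + k) - a - 2 * (a + k + 2 * w - a - (n + k) - w) = n := by ring
    have e4 : n + k - n = k := by ring
    have e5 : n + k + b + (a + k + 2 * w - a - (n + k) - w) = w + k + b := by ring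
    have e6 : a + k + 2 * w - a - (n + k) - w = w - n := by ring
    have e7 : n + k - b + a + (w - n) = w + a + k - b := by ring
    have e8 : w - n + a = w + a - n := by ring
    rw [e1, e2, e3, e4, e5, e6, e7, e8, zpow_add₀ ht0]
    ring
  simp_rw [h2]
  rw [finsum_comm_of_finite]
  swap
  · refine finite_of_int_bounds₂ 0 (L + b) 0 b fun x h => ?_
    simp only [midTerm, ne_eq, mul_eq_zero, not_or] at h
    obtain ⟨⟨⟨⟨⟨⟨⟨⟨⟨⟨-, -⟩, h1⟩, -⟩, -⟩, -⟩, -⟩, -⟩, h2⟩, h3⟩, h4⟩ := h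
    have := nonneg_of_qInvFac h1
    have := nonneg_of_qInvFac h2
    have := nonneg_of_qInvFac h3
    have := nonneg_of_qInvFac h4
    omega
  have h3 : ∀ j, ∑ᶠ w, midTerm t p M a b w (L - a - 2 * w) j =
      ∑ᶠ u, midTerm t p M a b (u + j) (L - a - 2 * (u + j)) j := fun j =>
    (finsum_add_right j fun w => midTerm t p M a b w (L - a - 2 * w) j).symm
  simp_rw [h3]
  rw [finsum_comm_of_finite]
  swap
  · refine finite_of_int_bounds₂ 0 b 0 (L + b) fun x h => ?_
    simp only [midTerm, ne_eq, mul_eq_zero, not_or] at h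
    obtain ⟨⟨⟨⟨⟨⟨⟨⟨⟨⟨-, -⟩, h1⟩, -⟩, -⟩, -⟩, -⟩, -⟩, h2⟩, h3⟩, h4⟩ := h
    have := nonneg_of_qInvFac h1
    have := nonneg_of_qInvFac h2
    have := nonneg_of_qInvFac h3
    have := nonneg_of_qInvFac h4
    omega
  simp_rw [finsum_midTerm ht hp hp0 hb hab]
  rw [trin, mul_finsum]

/-- On the line a = cb with c ≥ 1 the condition b ≤ a is automatic for b ≥ 0, and `trin_neg_neg`
covers b < 0. -/
theorem trin_transform_mul {t p : ℂ} (ht : t ^ 2 = p) (hp : ‖p‖ < 1) (hp0 : p ≠ 0) {c : ℤ}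
    (hc : 1 ≤ c) (b L M : ℤ) :
    ∑ᶠ i : ℤ, t ^ (i ^ 2) * qBinomial p (L + M - i) L * trin t p (L - i) i (c * b) b =
      t ^ (b ^ 2) * trin t p L M ((c + 1) * b) b := by
  rcases le_total 0 b with hb | hb
  · rw [trin_transform ht hp hp0 hb (by nlinarith), add_mul, one_mul]
  · have h := trin_transform ht hp hp0 (a := c * (-b)) (b := -b) (by omega) (by nlinarith) L M
    have e1 : c * -b = -(c * b) := by ring
    have e2 : c * -b + -b = -((c + 1) * b) := by ring
    rw [e2, e1] at h
    simp_rw [trin_neg_neg] at h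
    rw [h, neg_sq]

theorem trin_bounds {t p : ℂ} {L M a b : ℤ} (h : trin t p L M a b ≠ 0) :
    0 ≤ L ∧ 0 ≤ M ∧ -M ≤ b ∧ b ≤ M := by
  obtain ⟨u, hu⟩ := exists_ne_zero_of_finsum h
  have := trinTerm_bounds hu
  omega

/-! ### The limit of infinite second argument -/

/-- For d = c the product is eventually 1. Moving d by one step in either direction costs a factor 1
- p^(M + const), which tends to 1. -/
theorem tendsto_qFac_mul_qInvFac {p : ℂ} (hp : ‖p‖ < 1) (c d : ℤ) :
    Tendsto (fun M : ℕ => qFac p (M + c) * qInvFac p (M + d)) atTop (𝓝 1) := by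
  have step : ∀ d : ℤ, Tendsto (fun M : ℕ => 1 - p ^ ((M : ℤ) + d + 1)) atTop (𝓝 1) := by
    intro d
    have h : Tendsto (fun M : ℕ => p ^ ((M : ℤ) + d + 1)) atTop (𝓝 0) := by
      have h1 : Tendsto (fun M : ℕ => (M + d + 1).toNat) atTop atTop := by
        refine tendsto_atTop.mpr fun b => ?_
        filter_upwards [eventually_ge_atTop (b + d.natAbs + 1)] with M hM
        omega
      refine ((tendsto_pow_atTop_nhds_zero_of_norm_lt_one hp).comp h1).congr' ?_
      filter_upwards [eventually_ge_atTop d.natAbs] with M hM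
      rw [Function.comp_apply, ← zpow_natCast, Int.toNat_of_nonneg (by omega)]
    simpa using h.const_sub 1
  have base : Tendsto (fun M : ℕ => qFac p (M + c) * qInvFac p (M + c)) atTop (𝓝 1) := by
    refine tendsto_const_nhds.congr' ?_
    filter_upwards [eventually_ge_atTop c.natAbs] with M hM
    rw [qFac_mul_qInvFac hp (by omega)]
  have key : ∀ e : ℤ, Tendsto (fun M : ℕ => qFac p (M + c) * qInvFac p (M + (c + e))) atTop
      (𝓝 1) := by
    intro e
    induction e with
    | zero => simpa using base
    | succ e ih =>
      have h := ih.div (step (c + e)) one_ne_zero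
      rw [div_one] at h
      refine h.congr' ?_
      filter_upwards [(step (c + e)).eventually_ne one_ne_zero] with M hM
      simp only [Pi.div_apply]
      rw [qInvFac_eq_mul hp ((M : ℤ) + (c + e)),
        show (M : ℤ) + (c + (e + 1)) = M + (c + e) + 1 by ring]
      field_simp
    | pred e ih =>
      have h := ih.mul (step (c + (-e - 1)))
      rw [one_mul] at h
      refine h.congr fun M => ?_
      rw [qInvFac_eq_mul hp ((M : ℤ) + (c + (-e - 1))),
        show (M : ℤ) + (c + -e) = M + (c + (-e - 1)) + 1 by ring]
      ring
  simpa using key (d - c)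

/-- The summand of the limiting trinomial coefficient. -/
noncomputable def trinLimTerm (t p : ℂ) (L a u : ℤ) : ℂ :=
  t ^ ((L - a - 2 * u) ^ 2) * qInvFac p (L - a - 2 * u) * qInvFac p u * qInvFac p (u + a)

/-- The limit of the refined trinomial coefficient as its second argument tends to infinity. -/
noncomputable def trinLim (t p : ℂ) (L a : ℤ) : ℂ := ∑ᶠ u, trinLimTerm t p L a u

theorem trinLimTerm_bounds {t p : ℂ} {L a u : ℤ} (h : trinLimTerm t p L a u ≠ 0) :
    0 ≤ u ∧ 0 ≤ u + a ∧ 0 ≤ L - a - 2 * u := by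
  simp only [trinLimTerm, ne_eq, mul_eq_zero, not_or] at h
  obtain ⟨⟨⟨-, h1⟩, h2⟩, h3⟩ := h
  exact ⟨nonneg_of_qInvFac h2, nonneg_of_qInvFac h3, nonneg_of_qInvFac h1⟩

/-- The support in u lies in a finite interval independent of M, so the limit may be taken term by
term. -/
theorem tendsto_trin {t p : ℂ} (hp : ‖p‖ < 1) (L a b : ℤ) :
    Tendsto (fun M : ℕ => trin t p L M a b) atTop (𝓝 (trinLim t p L a)) := by
  have h1 : ∀ M : ℕ, trin t p L M a b = ∑ u ∈ Finset.Icc 0 (L + |a|), trinTerm t p L M a b u := by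
    intro M
    refine finsum_eq_sum_of_support_subset _ fun u hu => ?_
    have h := trinTerm_bounds hu
    have := neg_abs_le a
    rw [Finset.mem_coe, Finset.mem_Icc]
    omega
  have h2 : trinLim t p L a = ∑ u ∈ Finset.Icc 0 (L + |a|), trinLimTerm t p L a u := by
    refine finsum_eq_sum_of_support_subset _ fun u hu => ?_
    have h := trinLimTerm_bounds hu
    have := neg_abs_le a
    rw [Finset.mem_coe, Finset.mem_Icc]
    omega
  simp_rw [h1]
  rw [h2]
  refine tendsto_finsetSum _ fun u _ => ?_
  have l1 := tendsto_qFac_mul_qInvFac hp 0 (-(L - a - 2 * u))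
  have l2 := tendsto_qFac_mul_qInvFac hp (b + u) b
  have l3 := tendsto_qFac_mul_qInvFac hp (-b + a + u) (-b)
  have l := ((l1.mul l2).mul l3).const_mul (trinLimTerm t p L a u)
  simp only [mul_one] at l
  refine l.congr fun M => ?_
  unfold trinTerm trinLimTerm
  have e1 : (M : ℤ) + -(L - a - 2 * u) = M - (L - a - 2 * u) := by ring
  have e2 : (M : ℤ) + (b + u) = M + b + u := by ring
  have e3 : (M : ℤ) + (-b + a + u) = M - b + a + u := by ring
  rw [e1, e2, e3, add_zero, ← sub_eq_add_neg]
  ring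

/-- The limiting case of the transformation formula for refined trinomial coefficients. -/
theorem trin_transform_lim {t p : ℂ} (ht : t ^ 2 = p) (hp : ‖p‖ < 1) (hp0 : p ≠ 0) {c : ℤ}
    (hc : 1 ≤ c) (b L : ℤ) :
    qInvFac p L * ∑ᶠ i : ℤ, t ^ (i ^ 2) * trin t p (L - i) i (c * b) b =
      t ^ (b ^ 2) * trinLim t p L ((c + 1) * b) := by
  have hsupp : ∀ i : ℤ, trin t p (L - i) i (c * b) b ≠ 0 → i ∈ Finset.Icc 0 L := by
    intro i hi
    have := trin_bounds hi
    rw [Finset.mem_Icc]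
    omega
  have h1 : ∀ M : ℕ, ∑ i ∈ Finset.Icc 0 L, t ^ (i ^ 2) * qBinomial p (L + M - i) L *
      trin t p (L - i) i (c * b) b = t ^ (b ^ 2) * trin t p L M ((c + 1) * b) b := by
    intro M
    rw [← trin_transform_mul ht hp hp0 hc]
    exact (finsum_eq_sum_of_support_subset _ fun i hi => hsupp i (right_ne_zero_of_mul hi)).symm
  have h2 : ∑ᶠ i : ℤ, t ^ (i ^ 2) * trin t p (L - i) i (c * b) b =
      ∑ i ∈ Finset.Icc 0 L, t ^ (i ^ 2) * trin t p (L - i) i (c * b) b :=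
    finsum_eq_sum_of_support_subset _ fun i hi => hsupp i (right_ne_zero_of_mul hi)
  have h3 := (tendsto_trin (t := t) hp L ((c + 1) * b) b).const_mul (t ^ (b ^ 2))
  simp_rw [← h1] at h3
  refine tendsto_nhds_unique ?_ h3
  rw [h2, Finset.mul_sum]
  refine tendsto_finsetSum _ fun i _ => ?_
  -- On this side M enters only through [L+M-i, L], which tends to 1/(p;p)_L.
  have l := (tendsto_qFac_mul_qInvFac hp (L - i) (-i)).const_mul
    (qInvFac p L * (t ^ (i ^ 2) * trin t p (L - i) i (c * b) b))
  rw [mul_one] at l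
  refine l.congr fun M => ?_
  rw [qBinomial_eq, show L + (M : ℤ) - i - L = M + -i by ring,
    show L + (M : ℤ) - i = M + (L - i) by ring]
  ring

/-- Put r = i - a - u and m = u. Since (m+r+a)² + (r-m)² = a² + 2r(r+a) + 2m(m+a), the double sum
separates into a Vandermonde sum over m for fixed r, followed by another over r. -/
theorem finsum_trinLim {t p : ℂ} (ht : t ^ 2 = p) (hp : ‖p‖ < 1) (hp0 : p ≠ 0) (M : ℕ) (a : ℤ) :
    ∑ᶠ i : ℤ, t ^ (i ^ 2) * qBinomial p M i * qFac p i * trinLim t p i a =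
      t ^ (a ^ 2) * qBinomial p (2 * M) (M + a) := by
  have ht0 : t ≠ 0 := by rintro rfl; apply hp0; rw [← ht]; simp
  have h1 : ∀ i : ℤ, t ^ (i ^ 2) * qBinomial p M i * qFac p i * trinLim t p i a =
      ∑ᶠ r, t ^ (i ^ 2) * qBinomial p M i * qFac p i * trinLimTerm t p i a (i - a - r) := by
    intro i
    rw [trinLim, ← mul_finsum, finsum_sub_left (i - a)]
  simp_rw [h1]
  rw [finsum_comm_of_finite]
  swap
  · refine finite_of_int_bounds₂ 0 M (-|a|) M fun x h => ?_
    have h3 := trinLimTerm_bounds (right_ne_zero_of_mul h)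
    rw [qBinomial_eq] at h
    simp only [ne_eq, mul_eq_zero, not_or] at h
    have h4 := nonneg_of_qInvFac h.1.1.2.1.2
    have h5 := nonneg_of_qInvFac h.1.1.2.2
    have := neg_abs_le a
    have := le_abs_self a
    omega
  have h2 : ∀ r, ∑ᶠ i : ℤ, t ^ (i ^ 2) * qBinomial p M i * qFac p i *
        trinLimTerm t p i a (i - a - r) =
      t ^ (a ^ 2) * qFac p M * qFac p M * vandTerm p M (M - a) a r := by
    intro r
    rw [← finsum_add_right (r + a)]
    have h := vandermonde hp hp0 r (M - r - a) a
    have hV : ∀ m : ℤ, t ^ ((m + (r + a)) ^ 2) * qBinomial p M (m + (r + a)) *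
        qFac p (m + (r + a)) * trinLimTerm t p (m + (r + a)) a (m + (r + a) - a - r) =
        (t ^ (a ^ 2) * p ^ (r * (r + a)) * qFac p M) * vandTerm p r (M - r - a) a m := by
      intro m
      unfold trinLimTerm vandTerm
      rw [qBinomial_eq]
      have e1 : m + (r + a) - a - r = m := by ring
      have e2 : m + (r + a) - a - 2 * m = r - m := by ring
      have e3 : (M : ℤ) - (m + (r + a)) = M - r - a - m := by ring
      have e4 : t ^ ((m + (r + a)) ^ 2) * t ^ ((r - m) ^ 2) =
          t ^ (a ^ 2) * p ^ (r * (r + a)) * p ^ (m * (m + a)) := by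
        rw [zpow_of_sq ht, zpow_of_sq ht, ← zpow_add₀ ht0, ← zpow_add₀ ht0, ← zpow_add₀ ht0]
        congr 1; ring
      rw [e1, e2, e3]
      by_cases hk : 0 ≤ r - m ∧ 0 ≤ m ∧ 0 ≤ m + a
      · have f := qFac_mul_qInvFac hp (n := m + (r + a)) (by omega)
        linear_combination (qFac p M * qInvFac p (M - r - a - m) *
          qInvFac p (r - m) * qInvFac p m * qInvFac p (m + a)) *
          (e4 * (qFac p (m + (r + a)) * qInvFac p (m + (r + a))) +
            t ^ (a ^ 2) * p ^ (r * (r + a)) * p ^ (m * (m + a)) * f)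
      · rw [not_and_or, not_and_or, not_le, not_le, not_le] at hk
        rcases hk with h | h | h <;> simp [qInvFac_of_neg h]
    simp_rw [hV]
    rw [← mul_finsum, h]
    unfold vandTerm
    have e1 : r + (M - r - a) + a = (M : ℤ) := by ring
    have e2 : (M : ℤ) - r - a + a = M - r := by ring
    have e3 : (M : ℤ) - a - r = M - r - a := by ring
    rw [e1, e2, e3]
    ring
  simp_rw [h2]
  rw [← mul_finsum, vandermonde hp hp0, qBinomial_eq]
  have e1 : (M : ℤ) + (M - a) + a = 2 * M := by ring
  have e2 : (M : ℤ) - a + a = M := by ring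
  have e3 : 2 * (M : ℤ) - (M + a) = M - a := by ring
  rw [e1, e2, e3]
  have f := qFac_mul_qInvFac hp (n := M) (by omega)
  linear_combination (t ^ (a ^ 2) * qFac p (2 * M) * qInvFac p (M - a) * qInvFac p (M + a)) *
    (f * (qFac p M * qInvFac p M) + f)

/-! ### Bilateral sums of refined trinomial coefficients -/

/-- The weighted sum over `b` of the trinomial coefficients with third argument `c b`. -/
noncomputable def trinSum (t p w : ℂ) (c L M : ℤ) : ℂ :=
  ∑ᶠ b : ℤ, w ^ b * t ^ (c * b ^ 2) * trin t p L M (c * b) b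

theorem trinSum_step {t p : ℂ} (ht : t ^ 2 = p) (hp : ‖p‖ < 1) (hp0 : p ≠ 0) {c : ℤ}
    (hc : 1 ≤ c) (w : ℂ) (L M : ℤ) :
    ∑ᶠ i : ℤ, t ^ (i ^ 2) * qBinomial p (L + M - i) L * trinSum t p w c (L - i) i =
      trinSum t p w (c + 1) L M := by
  have ht0 : t ≠ 0 := by rintro rfl; apply hp0; rw [← ht]; simp
  simp_rw [trinSum, mul_finsum]
  rw [finsum_comm_of_finite]
  · refine finsum_congr fun b => ?_
    have h := trin_transform_mul ht hp hp0 hc b L M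
    have e : t ^ ((c + 1) * b ^ 2) = t ^ (c * b ^ 2) * t ^ (b ^ 2) := by
      rw [← zpow_add₀ ht0]; congr 1; ring
    have e2 : w ^ b * (t ^ (c * b ^ 2) * t ^ (b ^ 2)) * trin t p L M ((c + 1) * b) b =
        w ^ b * t ^ (c * b ^ 2) * (t ^ (b ^ 2) * trin t p L M ((c + 1) * b) b) := by ring
    rw [e, e2, ← h, mul_finsum]
    refine finsum_congr fun i => ?_
    ring
  · refine finite_of_int_bounds₂ 0 L (-L) L fun x h => ?_
    have := trin_bounds (right_ne_zero_of_mul (right_ne_zero_of_mul h))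
    omega

theorem trinSum_total {t p : ℂ} (ht : t ^ 2 = p) (hp : ‖p‖ < 1) (hp0 : p ≠ 0) {c : ℤ}
    (hc : 1 ≤ c) (w : ℂ) (M : ℕ) :
    ∑ᶠ i : ℤ, t ^ (i ^ 2) * qBinomial p M i *
        ∑ᶠ n : ℤ, t ^ (n ^ 2) * trinSum t p w c (i - n) n =
      ∑ᶠ b : ℤ, w ^ b * t ^ ((c + 1) * (c + 2) * b ^ 2) *
        qBinomial p (2 * M) (M + (c + 1) * b) := by
  have ht0 : t ≠ 0 := by rintro rfl; apply hp0; rw [← ht]; simp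
  have h1 : ∀ i : ℤ, t ^ (i ^ 2) * qBinomial p M i *
      ∑ᶠ n : ℤ, t ^ (n ^ 2) * trinSum t p w c (i - n) n =
      ∑ᶠ b : ℤ, w ^ b * t ^ ((c + 1) * b ^ 2) *
        (t ^ (i ^ 2) * qBinomial p M i * qFac p i * trinLim t p i ((c + 1) * b)) := by
    intro i
    by_cases hi : 0 ≤ i
    swap
    · rw [qBinomial_eq, qInvFac_of_neg (not_le.mp hi)]
      simp
    simp_rw [trinSum, mul_finsum]
    rw [finsum_comm_of_finite]
    · refine finsum_congr fun b => ?_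
      have h := trin_transform_lim ht hp hp0 hc b i
      have e : t ^ ((c + 1) * b ^ 2) = t ^ (c * b ^ 2) * t ^ (b ^ 2) := by
        rw [← zpow_add₀ ht0]; congr 1; ring
      have h2 : ∑ᶠ n : ℤ, t ^ (i ^ 2) * qBinomial p M i *
          (t ^ (n ^ 2) * (w ^ b * t ^ (c * b ^ 2) * trin t p (i - n) n (c * b) b)) =
          t ^ (i ^ 2) * qBinomial p M i * (w ^ b * t ^ (c * b ^ 2)) *
            ∑ᶠ n : ℤ, t ^ (n ^ 2) * trin t p (i - n) n (c * b) b := by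
        rw [mul_finsum]
        exact finsum_congr fun n => by ring
      rw [h2, e]
      linear_combination (t ^ (i ^ 2) * qBinomial p M i * (w ^ b * t ^ (c * b ^ 2))) *
        (qFac p i * h - (qFac_mul_qInvFac hp hi) *
          ∑ᶠ n : ℤ, t ^ (n ^ 2) * trin t p (i - n) n (c * b) b)
    · refine finite_of_int_bounds₂ 0 i (-i) i fun x h => ?_
      have := trin_bounds (right_ne_zero_of_mul (right_ne_zero_of_mul (right_ne_zero_of_mul h)))
      omega
  simp_rw [h1]
  rw [finsum_comm_of_finite]
  · refine finsum_congr fun b => ?_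
    rw [← mul_finsum, finsum_trinLim ht hp hp0]
    have e : t ^ ((c + 1) * (c + 2) * b ^ 2) = t ^ ((c + 1) * b ^ 2) * t ^ (((c + 1) * b) ^ 2) := by
      rw [← zpow_add₀ ht0]; congr 1; ring
    rw [e]
    ring
  · refine finite_of_int_bounds₂ 0 M (-M) M fun x h => ?_
    obtain ⟨u, hu⟩ := exists_ne_zero_of_finsum
      (right_ne_zero_of_mul (right_ne_zero_of_mul h))
    have h3 := trinLimTerm_bounds hu
    have h4 := left_ne_zero_of_mul (left_ne_zero_of_mul (right_ne_zero_of_mul h))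
    rw [qBinomial_eq] at h4
    have h5 := nonneg_of_qInvFac (right_ne_zero_of_mul (right_ne_zero_of_mul h4))
    have h6 : -(M : ℤ) ≤ (c + 1) * x.2 ∧ (c + 1) * x.2 ≤ M := by omega
    refine ⟨by omega, by omega, ?_, ?_⟩ <;> nlinarith

/-! ### The `q`-binomial theorem -/

/-- The coefficient of a polynomial with an integer index. -/
noncomputable def intCoeff (P : Polynomial ℂ) (n : ℤ) : ℂ := if 0 ≤ n then P.coeff n.toNat else 0

theorem nonneg_of_intCoeff {P : Polynomial ℂ} {n : ℤ} (h : intCoeff P n ≠ 0) : 0 ≤ n := by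
  by_contra hn
  exact h (by simp [intCoeff, hn])

theorem intCoeff_mul (P Q : Polynomial ℂ) (n : ℤ) :
    intCoeff (P * Q) n = ∑ᶠ k, intCoeff P k * intCoeff Q (n - k) := by
  by_cases hn : 0 ≤ n
  · lift n to ℕ using hn
    rw [finsum_eq_sum_of_support_subset (s := (Finset.range (n + 1)).map Nat.castEmbedding)]
    · rw [Finset.sum_map]
      simp only [intCoeff, Int.natCast_nonneg, if_true, Int.toNat_natCast]
      rw [Polynomial.coeff_mul, Finset.Nat.sum_antidiagonal_eq_sum_range_succ
        (fun i j => P.coeff i * Q.coeff j)]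
      refine Finset.sum_congr rfl fun k hk => ?_
      rw [Finset.mem_range] at hk
      have h2 : ((n : ℤ) - k).toNat = n - k := by omega
      simp [show k ≤ n by omega, h2]
    · intro k hk
      have h1 := nonneg_of_intCoeff (left_ne_zero_of_mul hk)
      have h2 := nonneg_of_intCoeff (right_ne_zero_of_mul hk)
      rw [Finset.mem_coe, Finset.mem_map]
      exact ⟨k.toNat, Finset.mem_range.mpr (by omega), by simp [h1]⟩
  · rw [finsum_eq_zero_of_forall_eq_zero]
    · simp [intCoeff, hn]
    · intro k
      by_contra h
      have h1 := nonneg_of_intCoeff (left_ne_zero_of_mul h)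
      have h2 := nonneg_of_intCoeff (right_ne_zero_of_mul h)
      omega

/-- The polynomial `(-c X; p)_n`. -/
noncomputable def qPoly (p c : ℂ) (n : ℕ) : Polynomial ℂ :=
  ∏ k ∈ Finset.range n, (1 + Polynomial.C (c * p ^ k) * Polynomial.X)

theorem intCoeff_qPoly_succ (p c : ℂ) (n : ℕ) (m : ℤ) :
    intCoeff (qPoly p c (n + 1)) m =
      intCoeff (qPoly p c n) m + c * p ^ n * intCoeff (qPoly p c n) (m - 1) := by
  have h : qPoly p c (n + 1) =
      qPoly p c n + Polynomial.C (c * p ^ n) * (qPoly p c n * Polynomial.X) := by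
    rw [qPoly, Finset.prod_range_succ, ← qPoly]
    ring
  rw [h]
  unfold intCoeff
  by_cases hm : 0 ≤ m
  · lift m to ℕ using hm
    cases m with
    | zero => simp
    | succ m =>
      have h1 : ((m + 1 : ℕ) : ℤ) - 1 = m := by push_cast; ring
      simp only [Int.natCast_nonneg, if_true, Int.toNat_natCast, h1, Polynomial.coeff_add,
        Polynomial.coeff_C_mul, Polynomial.coeff_mul_X]
  · simp only [hm, if_false, show ¬ (0 ≤ m - 1) by omega, mul_zero, add_zero]

theorem qBinomial_pascal {p : ℂ} (hp : ‖p‖ < 1) (hp0 : p ≠ 0) (n : ℕ) (m : ℤ) :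
    qBinomial p (n + 1) m = qBinomial p n m + p ^ ((n : ℤ) + 1 - m) * qBinomial p n (m - 1) := by
  rw [qBinomial_eq, qBinomial_eq, qBinomial_eq, qFac_succ p (Int.natCast_nonneg n)]
  have e1 : (n : ℤ) - m = n + 1 - m - 1 := by ring
  have e2 : (n : ℤ) - (m - 1) = n + 1 - m := by ring
  have e3 : p ^ ((n : ℤ) + 1) = p ^ ((n : ℤ) + 1 - m) * p ^ m := by
    rw [← zpow_add₀ hp0]; congr 1; ring
  rw [e1, e2, qInvFac_pred hp, qInvFac_pred hp, e3]
  ring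

/-- The q-binomial theorem, by induction through the Pascal rule; the usual c^m p^(m(m-1)/2) is
written with r = p^(1/2). -/
theorem intCoeff_qPoly {r p c : ℂ} (hr : r ^ 2 = p) (hp : ‖p‖ < 1) (hp0 : p ≠ 0) (hc : c ≠ 0)
    (n : ℕ) (m : ℤ) :
    intCoeff (qPoly p c n) m = (c / r) ^ m * r ^ (m ^ 2) * qBinomial p n m := by
  have hr0 : r ≠ 0 := by rintro rfl; apply hp0; rw [← hr]; simp
  induction n generalizing m with
  | zero =>
    rcases lt_trichotomy m 0 with h | rfl | h
    · rw [qBinomial_eq, qInvFac_of_neg h]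
      simp [intCoeff, not_le.mpr h]
    · simp [intCoeff, qPoly, qBinomial_eq]
    · rw [qBinomial_eq, qInvFac_of_neg (show ((0 : ℕ) : ℤ) - m < 0 by push_cast; omega)]
      simp [intCoeff, qPoly, Polynomial.coeff_one, h.le, show m.toNat ≠ 0 by omega]
  | succ n ih =>
    rw [intCoeff_qPoly_succ, ih, ih]
    push_cast
    rw [qBinomial_pascal hp hp0]
    have e : c * p ^ n * ((c / r) ^ (m - 1) * r ^ ((m - 1) ^ 2)) =
        (c / r) ^ m * r ^ (m ^ 2) * p ^ ((n : ℤ) + 1 - m) := by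
      have e1 : (c / r) ^ m = (c / r) ^ (m - 1) * (c / r) := by
        rw [zpow_sub_one₀ (div_ne_zero hc hr0)]; field_simp
      have e2 : r ^ ((m - 1) ^ 2) * r ^ (2 * (n : ℤ)) * r =
          r ^ (m ^ 2) * r ^ (2 * ((n : ℤ) + 1 - m)) := by
        rw [← zpow_add₀ hr0, ← zpow_add_one₀ hr0, ← zpow_add₀ hr0]; congr 1; ring
      rw [e1, ← zpow_natCast, zpow_of_sq hr, zpow_of_sq hr, mul_assoc _ (r ^ (m ^ 2)), ← e2]
      field_simp
    linear_combination qBinomial p n (m - 1) * e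

theorem qPoly_three_mul (q c : ℂ) (n : ℕ) :
    qPoly q c (3 * n) =
      (qPoly (q ^ 3) c n * qPoly (q ^ 3) (c * q ^ 2) n) * qPoly (q ^ 3) (c * q) n := by
  induction n with
  | zero => simp [qPoly]
  | succ n ih =>
    rw [show 3 * (n + 1) = 3 * n + 1 + 1 + 1 by ring]
    unfold qPoly at ih ⊢
    rw [Finset.prod_range_succ, Finset.prod_range_succ, Finset.prod_range_succ,
      Finset.prod_range_succ, Finset.prod_range_succ, Finset.prod_range_succ, ih]
    have e1 : c * q ^ (3 * n) = c * (q ^ 3) ^ n := by rw [pow_mul]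
    have e2 : c * q ^ (3 * n + 1) = c * q * (q ^ 3) ^ n := by rw [← pow_mul]; ring
    have e3 : c * q ^ (3 * n + 1 + 1) = c * q ^ 2 * (q ^ 3) ^ n := by rw [← pow_mul]; ring
    rw [e1, e2, e3]
    ring

theorem norm_cube_lt_one {q : ℂ} (hq : ‖q‖ < 1) : ‖q ^ 3‖ < 1 := by
  rw [norm_pow]
  exact pow_lt_one₀ (norm_nonneg _) hq three_ne_zero

/-- The cubic convolution of Gaussian binomial coefficients. -/
theorem cubic_convolution {s q : ℂ} (hs : s ^ 2 = q) (hq : ‖q‖ < 1) (hq0 : q ≠ 0) (n : ℕ)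
    (m : ℤ) :
    ∑ᶠ b : ℤ, ∑ᶠ r : ℤ, q ^ b * (s ^ 3) ^ ((m - b - 2 * r) ^ 2 + r ^ 2 + (r + b) ^ 2) *
        qBinomial (q ^ 3) n (m - b - 2 * r) * qBinomial (q ^ 3) n r *
        qBinomial (q ^ 3) n (r + b) =
      s ^ (m ^ 2) * qBinomial q (3 * n) m := by
  have hs0 : s ≠ 0 := by rintro rfl; apply hq0; rw [← hs]; simp
  have ht0 : s ^ 3 ≠ 0 := pow_ne_zero 3 hs0
  have hp0 : q ^ 3 ≠ 0 := pow_ne_zero 3 hq0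
  have hp := norm_cube_lt_one hq
  have ht : (s ^ 3) ^ 2 = q ^ 3 := by rw [← hs]; ring
  have h1 := intCoeff_qPoly hs hq hq0 hs0 (3 * n) m
  rw [div_self hs0, one_zpow, one_mul] at h1
  push_cast at h1
  have hA := fun m => intCoeff_qPoly ht hp hp0 hs0 n m
  have hB := fun m => intCoeff_qPoly ht hp hp0 (mul_ne_zero hs0 (pow_ne_zero 2 hq0)) n m
  have hC := fun m => intCoeff_qPoly ht hp hp0 (mul_ne_zero hs0 hq0) n m
  rw [← h1, qPoly_three_mul, intCoeff_mul]
  simp_rw [intCoeff_mul, finsum_mul]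
  refine (finsum_comm_of_finite _ ?_).trans (Eq.trans ?_ (finsum_comm_of_finite _ ?_))
  · refine finite_of_int_bounds₂ (-n) n 0 n fun x h => ?_
    simp only [qBinomial_eq, ne_eq, mul_eq_zero, not_or] at h
    obtain ⟨⟨-, ⟨-, h1⟩, h2⟩, ⟨-, h3⟩, h4⟩ := h
    have := nonneg_of_qInvFac h1
    have := nonneg_of_qInvFac h2
    have := nonneg_of_qInvFac h3
    have := nonneg_of_qInvFac h4
    omega
  · refine finsum_congr fun r => ?_
    refine Eq.trans ?_ (finsum_add_right (2 * r) _)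
    refine finsum_congr fun b => ?_
    rw [hA, hB, hC]
    have e1 : b + 2 * r - r = r + b := by ring
    have e2 : m - (b + 2 * r) = m - b - 2 * r := by ring
    -- The three residue classes mod 3 carry the weights 1, q and 1/q. The last two, at indices r +
    -- b and r, combine to q^b.
    have e3 : s * q / s ^ 3 = 1 := by rw [← hs]; field_simp
    have e4 : s * q ^ 2 / s ^ 3 = q := by rw [← hs]; field_simp
    have e5 : s / s ^ 3 = q⁻¹ := by rw [← hs]; field_simp
    have e6 : q⁻¹ ^ r * q ^ (r + b) = q ^ b := by
      rw [zpow_add₀ hq0, inv_zpow, ← mul_assoc, inv_mul_cancel₀ (zpow_ne_zero r hq0), one_mul]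
    rw [e1, e2, e3, e4, e5, one_zpow, one_mul, zpow_add₀ ht0, zpow_add₀ ht0, ← e6]
    ring
  · refine finite_of_int_bounds₂ 0 m 0 m fun x h => ?_
    have h2 := nonneg_of_intCoeff (left_ne_zero_of_mul (left_ne_zero_of_mul h))
    have h3 := nonneg_of_intCoeff (right_ne_zero_of_mul (left_ne_zero_of_mul h))
    have h4 := nonneg_of_intCoeff (right_ne_zero_of_mul h)
    omega

/-! ### The initial identity -/

/-- At a = b the last two factor groups form the closed side of a Saalschütz sum with parameters M,
M - b, u and shift b. -/
theorem trinTerm_self_expansion {t p : ℂ} (hp : ‖p‖ < 1) (hp0 : p ≠ 0) (L b u : ℤ) (M : ℕ) :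
    trinTerm t p L M b b u = ∑ᶠ r, t ^ ((L - b - 2 * u) ^ 2) * qBinomial p M (L - b - 2 * u) *
      p ^ (r * (r + b)) * qBinomial p M r * qBinomial p M (r + b) *
      qBinomial p (2 * M + (u - r)) (2 * M) := by
  have h := saalschutz hp hp0 M (M - b) u b
  have h1 : ∀ r, t ^ ((L - b - 2 * u) ^ 2) * qBinomial p M (L - b - 2 * u) *
      p ^ (r * (r + b)) * qBinomial p M r * qBinomial p M (r + b) *
      qBinomial p (2 * M + (u - r)) (2 * M) =
      (t ^ ((L - b - 2 * u) ^ 2) * qBinomial p M (L - b - 2 * u) * qFac p M * qFac p M *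
        qInvFac p (2 * M)) * saalTerm p M (M - b) u b r := by
    intro r
    rw [qBinomial_eq p M r, qBinomial_eq p M (r + b), qBinomial_eq p (2 * M + (u - r))]
    unfold saalTerm
    have e1 : (M : ℤ) + (M - b) + u + b - r = 2 * M + (u - r) := by ring
    have e2 : (M : ℤ) - b - r = M - (r + b) := by ring
    have e3 : 2 * (M : ℤ) + (u - r) - 2 * M = u - r := by ring
    rw [e1, e2, e3]
    ring
  simp_rw [h1]
  rw [← mul_finsum, h, qBinomial_eq]
  unfold trinTerm
  have e1 : (M : ℤ) + (M - b) + b = 2 * M := by ring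
  have e2 : (M : ℤ) + u + b = M + b + u := by ring
  have e3 : (M : ℤ) - b + u + b = M - b + b + u := by ring
  have e4 : (M : ℤ) - b + b = M := by ring
  rw [e1, e2, e3, e4]
  have f1 := qFac_mul_qInvFac hp (n := M) (by omega)
  have f2 := qFac_mul_qInvFac hp (n := 2 * M) (by omega)
  linear_combination (-(t ^ ((L - b - 2 * u) ^ 2) *
    (qFac p M * qInvFac p (L - b - 2 * u) * qInvFac p (M - (L - b - 2 * u))) *
    (qFac p (M + b + u) * qInvFac p (M + b) * qInvFac p u) *
    (qFac p (M + u) * qInvFac p (M - b) * qInvFac p (u + b)))) *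
    (f1 * (qFac p M * qInvFac p M) * (qFac p (2 * M) * qInvFac p (2 * M)) +
      f1 * (qFac p (2 * M) * qInvFac p (2 * M)) + f2)

/-- After the substitution u = v + r, the factor [2M+v, 2M] no longer sees b or r, and for fixed v
the sums over b and r are `cubic_convolution` with m = L - 2v. -/
theorem trinSum_one {s q : ℂ} (hs : s ^ 2 = q) (hq : ‖q‖ < 1) (hq0 : q ≠ 0) (L : ℤ) (M : ℕ) :
    trinSum (s ^ 3) (q ^ 3) q 1 L M =
      ∑ᶠ v : ℤ, s ^ ((L - 2 * v) ^ 2) * qBinomial q (3 * M) (L - 2 * v) *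
        qBinomial (q ^ 3) (2 * M + v) (2 * M) := by
  have hs0 : s ≠ 0 := by rintro rfl; apply hq0; rw [← hs]; simp
  have ht0 : s ^ 3 ≠ 0 := pow_ne_zero 3 hs0
  have hp0 : q ^ 3 ≠ 0 := pow_ne_zero 3 hq0
  have hp := norm_cube_lt_one hq
  have ht : (s ^ 3) ^ 2 = q ^ 3 := by rw [← hs]; ring
  have h1 : ∀ b : ℤ, q ^ b * (s ^ 3) ^ (1 * b ^ 2) * trin (s ^ 3) (q ^ 3) L M (1 * b) b =
      ∑ᶠ v : ℤ, ∑ᶠ r : ℤ, q ^ b *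
        (s ^ 3) ^ ((L - 2 * v - b - 2 * r) ^ 2 + r ^ 2 + (r + b) ^ 2) *
        qBinomial (q ^ 3) M (L - 2 * v - b - 2 * r) * qBinomial (q ^ 3) M r *
        qBinomial (q ^ 3) M (r + b) * qBinomial (q ^ 3) (2 * M + v) (2 * M) := by
    intro b
    rw [one_mul, one_mul, trin]
    simp_rw [trinTerm_self_expansion hp hp0, mul_finsum]
    refine (finsum_comm_of_finite _ ?_).trans (Eq.trans ?_ (finsum_comm_of_finite _ ?_))
    · refine finite_of_int_bounds₂ (-(M + |L| + |b|)) (M + |L| + |b|) 0 M fun x h => ?_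
      simp only [qBinomial_eq, ne_eq, mul_eq_zero, not_or] at h
      obtain ⟨-, ⟨⟨⟨⟨-, ⟨-, h1⟩, h2⟩, -⟩, ⟨-, h3⟩, h4⟩, -⟩, ⟨-, -⟩, h5⟩ := h
      have := nonneg_of_qInvFac h1
      have := nonneg_of_qInvFac h2
      have := nonneg_of_qInvFac h3
      have := nonneg_of_qInvFac h4
      have := nonneg_of_qInvFac h5
      have := le_abs_self L
      have := neg_abs_le L
      have := le_abs_self b
      have := neg_abs_le b
      omega
    · refine finsum_congr fun r => ?_
      rw [← finsum_add_right r]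
      refine finsum_congr fun v => ?_
      have e1 : L - b - 2 * (v + r) = L - 2 * v - b - 2 * r := by ring
      have e2 : v + r - r = v := by ring
      have e3 : (s ^ 3) ^ ((L - 2 * v - b - 2 * r) ^ 2 + r ^ 2 + (r + b) ^ 2) =
          (s ^ 3) ^ (b ^ 2) * (s ^ 3) ^ ((L - 2 * v - b - 2 * r) ^ 2) *
            (q ^ 3) ^ (r * (r + b)) := by
        rw [zpow_of_sq ht, ← zpow_add₀ ht0, ← zpow_add₀ ht0]; congr 1; ring
      rw [e1, e2, e3]
      ring
    · refine finite_of_int_bounds₂ 0 M (-(M + |L| + |b|)) (M + |L| + |b|) fun x h => ?_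
      simp only [qBinomial_eq, ne_eq, mul_eq_zero, not_or] at h
      obtain ⟨⟨⟨⟨-, ⟨-, h1⟩, h2⟩, ⟨-, h3⟩, h4⟩, -⟩, ⟨-, -⟩, h5⟩ := h
      have := nonneg_of_qInvFac h1
      have := nonneg_of_qInvFac h2
      have := nonneg_of_qInvFac h3
      have := nonneg_of_qInvFac h4
      have := nonneg_of_qInvFac h5
      have := le_abs_self L
      have := neg_abs_le L
      have := le_abs_self b
      have := neg_abs_le b
      omega
  unfold trinSum
  simp_rw [h1]
  rw [finsum_comm_of_finite]
  · refine finsum_congr fun v => ?_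
    rw [← cubic_convolution hs hq hq0, finsum_mul]
    refine finsum_congr fun b => ?_
    rw [finsum_mul]
  · refine finite_of_int_bounds₂ (-M) M (-(3 * M + |L|)) (3 * M + |L|) fun x h => ?_
    obtain ⟨r, hr⟩ := exists_ne_zero_of_finsum h
    simp only [qBinomial_eq, ne_eq, mul_eq_zero, not_or] at hr
    obtain ⟨⟨⟨⟨-, ⟨-, h1⟩, h2⟩, ⟨-, h3⟩, h4⟩, ⟨-, h5⟩, h6⟩, ⟨-, -⟩, h7⟩ := hr
    have := nonneg_of_qInvFac h1
    have := nonneg_of_qInvFac h2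
    have := nonneg_of_qInvFac h3
    have := nonneg_of_qInvFac h4
    have := nonneg_of_qInvFac h5
    have := nonneg_of_qInvFac h6
    have := nonneg_of_qInvFac h7
    have := le_abs_self L
    have := neg_abs_le L
    omega

/-! ### The multisum -/

theorem finsum_of_injective {α β : Type*} {g : α → β} (hg : Injective g) (f : β → ℂ)
    (h : ∀ b, f b ≠ 0 → b ∈ Set.range g) : ∑ᶠ b, f b = ∑ᶠ a, f (g a) := by
  rw [← finsum_mem_range hg, finsum_mem_def]
  refine finsum_congr fun b => ?_
  by_cases hb : f b = 0
  · simp [Set.indicator, hb]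
  · rw [Set.indicator_of_mem (h b hb)]

theorem finsum_natCast (f : ℤ → ℂ) (h : ∀ n, f n ≠ 0 → 0 ≤ n) :
    ∑ᶠ n : ℕ, f n = ∑ᶠ n : ℤ, f n :=
  (finsum_of_injective Nat.cast_injective f fun n hn => ⟨n.toNat, by simp [h n hn]⟩).symm

theorem finsum_even (K : ℤ) (f : ℤ → ℤ → ℂ) :
    ∑ᶠ m : ℤ, (if Even (K - m) then f m ((K - m) / 2) else 0) = ∑ᶠ v : ℤ, f (K - 2 * v) v := by
  rw [finsum_of_injective (g := fun v : ℤ => K - 2 * v) (fun a b h => by simp at h; omega)]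
  · refine finsum_congr fun v => ?_
    have e : K - (K - 2 * v) = 2 * v := by ring
    simp [e]
  · intro m hm
    have h : Even (K - m) := by
      by_contra h
      exact hm (by simp [h])
    obtain ⟨v, hv⟩ := h
    exact ⟨v, by dsimp only; omega⟩

theorem qBinomial_bounds {p : ℂ} {A B : ℤ} (h : qBinomial p A B ≠ 0) : 0 ≤ B ∧ B ≤ A := by
  rw [qBinomial_eq] at h
  have h1 := nonneg_of_qInvFac (right_ne_zero_of_mul h)
  have h2 := nonneg_of_qInvFac (right_ne_zero_of_mul (left_ne_zero_of_mul h))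
  omega

theorem tailSum_cons_zero {ν : ℕ} (a : ℕ) (n : Fin (ν + 1) → ℕ) :
    tailSum (Fin.cons a n : Fin (ν + 2) → ℕ) 0 = a + tailSum n 0 := by
  unfold tailSum
  have h1 : Finset.Ici (0 : Fin (ν + 2)) = Finset.univ := by ext; simp
  have h2 : Finset.Ici (0 : Fin (ν + 1)) = Finset.univ := by ext; simp
  rw [h1, h2, Fin.sum_univ_succ]
  simp

theorem tailSum_cons_succ {ν : ℕ} (a : ℕ) (n : Fin (ν + 1) → ℕ) (k : Fin (ν + 1)) :
    tailSum (Fin.cons a n : Fin (ν + 2) → ℕ) k.succ = tailSum n k := by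
  unfold tailSum
  have h1 : Finset.Ici k.succ = Finset.univ.filter (fun l => k.succ ≤ l) := by ext; simp
  have h2 : Finset.Ici k = Finset.univ.filter (fun l => k ≤ l) := by ext; simp
  rw [h1, h2, Finset.sum_filter, Finset.sum_filter, Fin.sum_univ_succ]
  simp

theorem le_tailSum {ν : ℕ} (n : Fin ν → ℕ) (k : Fin ν) : n k ≤ tailSum n k :=
  Finset.single_le_sum (f := n) (fun _ _ => Nat.zero_le _) (Finset.mem_Ici.mpr le_rfl)

theorem sum_Iic_succ {ν : ℕ} (f : Fin (ν + 1) → ℤ) (j : Fin ν) :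
    ∑ k ∈ Finset.Iic j.succ, f k = f 0 + ∑ k ∈ Finset.Iic j, f k.succ := by
  have h1 : Finset.Iic j.succ = Finset.univ.filter (fun l => l ≤ j.succ) := by ext; simp
  have h2 : Finset.Iic j = Finset.univ.filter (fun l => l ≤ j) := by ext; simp
  rw [h1, h2, Finset.sum_filter, Finset.sum_filter, Fin.sum_univ_succ]
  simp

/-- The part of the summand of the multisum that involves `(m, n_1, …, n_ν)`, as a function of an
integer `L` in place of `i`, and with value `0` where the parity condition fails. -/
noncomputable def innerTerm (ν : ℕ) (s q : ℂ) (L : ℤ) (m : ℕ) (n : Fin (ν + 1) → ℕ) : ℂ :=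
  if Even (L - ∑ k, (tailSum n k : ℤ) - m) then
    s ^ (m ^ 2 + 3 * ∑ k, tailSum n k ^ 2)
      * qBinomial q (3 * lastEntry ν.succ_pos n) m
      * qBinomial (q ^ 3)
          (2 * lastEntry ν.succ_pos n + (L - ∑ k, (tailSum n k : ℤ) - m) / 2)
          (2 * lastEntry ν.succ_pos n)
      * ∏ j ∈ Finset.univ.filter (fun j : Fin (ν + 1) => j.val + 1 < ν + 1),
          qBinomial (q ^ 3) (L - ∑ k ∈ Finset.Iic j, (tailSum n k : ℤ) + n j) (n j)
  else 0

/-- A new first entry leaves the later tail sums alone and adds N_1 to every partial sum, so the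
remaining factors see L - N_1 in place of L. This is why L is allowed to be any integer. -/
theorem innerTerm_cons (ν : ℕ) (s q : ℂ) (L : ℤ) (m a : ℕ) (n : Fin (ν + 1) → ℕ) :
    innerTerm (ν + 1) s q L m (Fin.cons a n) =
      (s ^ 3) ^ ((a + tailSum n 0) ^ 2) *
        qBinomial (q ^ 3) (L - (a + tailSum n 0 : ℕ) + a) a *
        innerTerm ν s q (L - (a + tailSum n 0 : ℕ)) m n := by
  have hl : lastEntry (ν + 1).succ_pos (Fin.cons a n : Fin (ν + 2) → ℕ) =
      lastEntry ν.succ_pos n := rfl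
  have h0 : Finset.Iic (0 : Fin (ν + 2)) = {0} := by ext; simp
  have hS : ∑ k, (tailSum (Fin.cons a n : Fin (ν + 2) → ℕ) k : ℤ) =
      (a + tailSum n 0 : ℕ) + ∑ k, (tailSum n k : ℤ) := by
    rw [Fin.sum_univ_succ, tailSum_cons_zero]
    simp only [tailSum_cons_succ]
  have hQ : ∑ k, tailSum (Fin.cons a n : Fin (ν + 2) → ℕ) k ^ 2 =
      (a + tailSum n 0) ^ 2 + ∑ k, tailSum n k ^ 2 := by
    rw [Fin.sum_univ_succ, tailSum_cons_zero]
    simp only [tailSum_cons_succ]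
  unfold innerTerm
  rw [hl, hS, hQ]
  simp only [Finset.prod_filter]
  rw [Fin.prod_univ_succ]
  simp only [tailSum_cons_zero, tailSum_cons_succ, sum_Iic_succ, Fin.cons_zero, Fin.cons_succ, h0,
    Finset.sum_singleton, Fin.val_zero, Fin.val_succ, ← sub_sub, Nat.add_lt_add_iff_right]
  by_cases h : Even (L - ↑(a + tailSum n 0) - ∑ k, (tailSum n k : ℤ) - m)
  · simp only [h, if_true, Nat.succ_pos]
    ring
  · rw [if_neg h, if_neg h, mul_zero]

/-- The binomial with bottom entry 2n_ν vanishes unless N_1 + ⋯ + N_ν + m ≤ L. -/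
theorem innerTerm_bounds {ν : ℕ} {s q : ℂ} {L : ℤ} {m : ℕ} {n : Fin (ν + 1) → ℕ}
    (h : innerTerm ν s q L m n ≠ 0) :
    m ≤ L.toNat ∧ (∀ k, tailSum n k ≤ L.toNat) ∧ ∀ k, n k ≤ L.toNat := by
  unfold innerTerm at h
  split_ifs at h
  · have h1 := qBinomial_bounds (right_ne_zero_of_mul (left_ne_zero_of_mul h))
    have h2 : ∀ k, (tailSum n k : ℤ) ≤ ∑ k, (tailSum n k : ℤ) := fun k =>
      Finset.single_le_sum (f := fun k => (tailSum n k : ℤ)) (fun _ _ => Int.natCast_nonneg _)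
        (Finset.mem_univ k)
    refine ⟨?_, fun k => ?_, fun k => ?_⟩
    · have := h2 0
      omega
    · have := h2 k
      omega
    · have := h2 k
      have := le_tailSum n k
      omega
  · exact absurd rfl h

/-- The sum of `innerTerm` over all `(m, n_1, …, n_ν)` with `N_1 = N`. -/
noncomputable def layer (ν : ℕ) (s q : ℂ) (L : ℤ) (N : ℕ) : ℂ :=
  ∑ᶠ x : ℕ × (Fin (ν + 1) → ℕ), if tailSum x.2 0 = N then innerTerm ν s q L x.1 x.2 else 0

theorem finite_of_nat_bounds {k : ℕ} {P : ℕ × (Fin k → ℕ) → Prop} (B : ℕ)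
    (h : ∀ x, P x → x.1 ≤ B ∧ ∀ j, x.2 j ≤ B) : {x | P x}.Finite :=
  ((Set.finite_Iic B).prod (Set.finite_Icc (0 : Fin k → ℕ) fun _ => B)).subset fun x hx =>
    ⟨(h x hx).1, fun _ => Nat.zero_le _, (h x hx).2⟩

theorem finite_of_nat_bounds₂ {k : ℕ} {P : ℕ × ℕ × (Fin k → ℕ) → Prop} (B : ℕ)
    (h : ∀ x, P x → x.1 ≤ B ∧ x.2.1 ≤ B ∧ ∀ j, x.2.2 j ≤ B) : {x | P x}.Finite :=
  ((Set.finite_Iic B).prod ((Set.finite_Iic B).prod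
    (Set.finite_Icc (0 : Fin k → ℕ) fun _ => B))).subset fun x hx =>
    ⟨(h x hx).1, (h x hx).2.1, fun _ => Nat.zero_le _, (h x hx).2.2⟩

theorem layer_zero {s q : ℂ} (hs : s ^ 2 = q) (hq : ‖q‖ < 1) (hq0 : q ≠ 0) (L : ℤ) (N : ℕ) :
    layer 0 s q L N = (s ^ 3) ^ (N ^ 2) * trinSum (s ^ 3) (q ^ 3) q 1 (L - N) N := by
  have ht : ∀ n : Fin 1 → ℕ, ∀ k, tailSum n k = n 0 := by
    intro n k
    have h : Finset.Ici k = {0} := by ext x; simp [Subsingleton.elim x k, Subsingleton.elim k 0]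
    rw [tailSum, h, Finset.sum_singleton]
  rw [layer, finsum_of_injective (g := fun m : ℕ => (m, fun _ : Fin 1 => N))
    (fun a b h => by simpa using h)]
  · obtain ⟨f, hf⟩ : ∃ f : ℤ → ℤ → ℂ, ∀ m v, f m v = (s ^ 3) ^ (N ^ 2) * (s ^ (m ^ 2) *
        qBinomial q (3 * N) m * qBinomial (q ^ 3) (2 * N + v) (2 * N)) := ⟨_, fun _ _ => rfl⟩
    have h1 : ∀ m : ℕ, (if tailSum (fun _ : Fin 1 => N) 0 = N then
        innerTerm 0 s q L m (fun _ => N) else 0) =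
        (fun m : ℤ => if Even (L - N - m) then f m ((L - N - m) / 2) else 0) (m : ℤ) := by
      intro m
      have h2 : ∀ F : Fin (0 + 1) → ℂ,
          ∏ j ∈ Finset.univ.filter (fun j : Fin (0 + 1) => j.val + 1 < 0 + 1), F j = 1 :=
        fun F => Finset.prod_eq_one fun j hj => by
          have := (Finset.mem_filter.mp hj).2
          omega
      rw [ht, if_pos rfl, innerTerm, h2]
      simp only [ht, Finset.sum_const, Finset.card_univ, Fintype.card_fin, zero_add, one_smul,
        lastEntry, hf]
      refine if_congr Iff.rfl ?_ rfl
      rw [pow_add, pow_mul]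
      have h3 : s ^ ((m : ℤ) ^ 2) = s ^ (m ^ 2) := by norm_cast
      rw [h3]
      ring
    simp_rw [h1]
    rw [finsum_natCast (fun m : ℤ => if Even (L - N - m) then f m ((L - N - m) / 2) else 0),
      finsum_even, trinSum_one hs hq hq0, mul_finsum]
    · exact finsum_congr fun v => hf _ _
    intro m hm
    split_ifs at hm
    · rw [hf] at hm
      exact (qBinomial_bounds (right_ne_zero_of_mul (left_ne_zero_of_mul
        (right_ne_zero_of_mul hm)))).1
    · exact absurd rfl hm
  · rintro ⟨m, n⟩ h
    refine ⟨m, ?_⟩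
    by_cases hn : tailSum n 0 = N
    · rw [ht] at hn
      have : (fun _ => N) = n := by funext x; rw [Subsingleton.elim x 0, hn]
      rw [this]
    · simp [hn] at h

theorem finsum_fiber {α : Type*} (g : α → ℕ) (f : α → ℂ) (c : ℕ → ℂ)
    (h : {x | f x ≠ 0}.Finite) :
    ∑ᶠ x, c (g x) * f x = ∑ᶠ N, c N * ∑ᶠ x, if g x = N then f x else 0 := by
  simp_rw [mul_finsum]
  rw [finsum_comm_of_finite]
  · refine finsum_congr fun x => ?_
    rw [finsum_eq_single _ (g x) fun N hN => by simp [hN.symm]]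
    simp
  · refine (h.image fun x => (g x, x)).subset ?_
    rintro ⟨N, x⟩ hx
    have h1 := right_ne_zero_of_mul hx
    simp only [ne_eq, ite_eq_right_iff, Classical.not_imp] at h1
    exact ⟨x, h1.2, by simp [h1.1]⟩

theorem innerTerm_finite (ν : ℕ) (s q : ℂ) (L : ℤ) :
    {x : ℕ × (Fin (ν + 1) → ℕ) | innerTerm ν s q L x.1 x.2 ≠ 0}.Finite :=
  finite_of_nat_bounds L.toNat fun _ hx =>
    ⟨(innerTerm_bounds hx).1, (innerTerm_bounds hx).2.2⟩

theorem layer_succ (ν : ℕ) (s q : ℂ) (L : ℤ) (N : ℕ) :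
    layer (ν + 1) s q L N = ∑ᶠ N' : ℕ, (s ^ 3) ^ (N ^ 2) *
      qBinomial (q ^ 3) (L - N') (N - N') * layer ν s q (L - N) N' := by
  unfold layer
  rw [← finsum_fiber (fun x : ℕ × (Fin (ν + 1) → ℕ) => tailSum x.2 0)
    (fun x => innerTerm ν s q (L - N) x.1 x.2)
    (fun N' => (s ^ 3) ^ (N ^ 2) * qBinomial (q ^ 3) (L - N') (N - N'))
    (innerTerm_finite ν s q (L - N))]
  let e : (ℕ × (Fin (ν + 1) → ℕ)) × ℕ ≃ ℕ × (Fin (ν + 2) → ℕ) :=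
    (Equiv.prodAssoc _ _ _).trans ((Equiv.refl ℕ).prodCongr ((Equiv.prodComm _ _).trans
      (Fin.consEquiv fun _ => ℕ)))
  rw [← finsum_comp_equiv e, finsum_curry]
  swap
  · have h1 := innerTerm_finite (ν + 1) s q L
    refine ((h1.preimage e.injective.injOn)).subset fun x hx => ?_
    by_contra h
    rw [Set.mem_preimage, Set.mem_ofPred_eq, not_not] at h
    exact hx (by simp [h])
  refine finsum_congr fun x => ?_
  obtain ⟨m, n⟩ := x
  have he : ∀ a, e ((m, n), a) = (m, Fin.cons a n) := fun a => rfl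
  simp only [he, tailSum_cons_zero, innerTerm_cons]
  by_cases hN : tailSum n 0 ≤ N
  · rw [finsum_eq_single _ (N - tailSum n 0)]
    · have e1 : N - tailSum n 0 + tailSum n 0 = N := by omega
      simp only [e1, if_true]
      have e2 : ((N - tailSum n 0 : ℕ) : ℤ) = N - tailSum n 0 := by omega
      rw [e2, show L - N + (N - tailSum n 0 : ℤ) = L - tailSum n 0 by ring]
    · intro a ha
      rw [if_neg (by omega)]
  -- If N_2 > N, no first entry gives N_1 = N; on the other side the binomial has negative bottom
  -- entry N - N_2.
  · rw [finsum_eq_zero_of_forall_eq_zero]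
    · rw [qBinomial, if_neg (by omega)]
      ring
    · intro a
      rw [if_neg (by omega)]

theorem layer_eq {s q : ℂ} (hs : s ^ 2 = q) (hq : ‖q‖ < 1) (hq0 : q ≠ 0) (ν : ℕ) (L : ℤ)
    (N : ℕ) :
    layer ν s q L N = (s ^ 3) ^ (N ^ 2) * trinSum (s ^ 3) (q ^ 3) q (ν + 1) (L - N) N := by
  have ht : (s ^ 3) ^ 2 = q ^ 3 := by rw [← hs]; ring
  induction ν generalizing L N with
  | zero => simpa using layer_zero hs hq hq0 L N
  | succ ν ih =>
    rw [layer_succ]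
    simp_rw [ih]
    push_cast
    rw [← trinSum_step ht (norm_cube_lt_one hq) (pow_ne_zero 3 hq0) (by omega), mul_finsum,
      ← finsum_natCast]
    · refine finsum_congr fun N' => ?_
      -- The recursion for layers has bottom entry N - N', `trinSum_step` has L - N; these are
      -- complementary.
      rw [qBinomial_eq, qBinomial_eq]
      have e1 : L - (N : ℤ) + N - N' = L - N' := by ring
      have e2 : L - (N' : ℤ) - (N - N') = L - N := by ring
      have e3 : L - (N' : ℤ) - (L - N) = N - N' := by ring
      have e4 : (s ^ 3) ^ ((N' : ℤ) ^ 2) = (s ^ 3) ^ (N' ^ 2) := by norm_cast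
      rw [e1, e2, e3, e4]
      ring
    · intro n hn
      obtain ⟨b, hb⟩ := exists_ne_zero_of_finsum (right_ne_zero_of_mul (right_ne_zero_of_mul hn))
      exact (trin_bounds (right_ne_zero_of_mul hb)).2.1

/-! ### Parity of the exponent and assembly of the identity for q ≠ 0. -/

theorem parityCondition_iff {ν i m : ℕ} {n : Fin (ν + 1) → ℕ} :
    ParityCondition i m n ↔ Even ((i : ℤ) - ∑ k, (tailSum n k : ℤ) - m) := by
  have h : (∑ k, (tailSum n k : ℤ)) = ((∑ k, tailSum n k : ℕ) : ℤ) := by push_cast; rfl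
  rw [h, Int.even_iff, ParityCondition, Nat.ModEq]
  omega

theorem sum_sq_mod_two {ν : ℕ} (f : Fin ν → ℕ) : (∑ k, f k ^ 2) % 2 = (∑ k, f k) % 2 := by
  rw [Finset.sum_nat_mod, Finset.sum_nat_mod _ _ f]
  congr 1
  refine Finset.sum_congr rfl fun k _ => ?_
  rw [Nat.pow_mod]
  rcases Nat.mod_two_eq_zero_or_one (f k) with h | h <;> rw [h]

theorem exponent_even {ν i m : ℕ} {n : Fin ν → ℕ} (h : ParityCondition i m n) :
    Even (m ^ 2 + 3 * (i ^ 2 + ∑ k, tailSum n k ^ 2)) := by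
  have h1 := sum_sq_mod_two (tailSum n)
  have h2 : m ^ 2 % 2 = m % 2 := by
    simpa using sum_sq_mod_two (fun _ : Fin 1 => m)
  have h3 : i ^ 2 % 2 = i % 2 := by
    simpa using sum_sq_mod_two (fun _ : Fin 1 => i)
  rw [ParityCondition, Nat.ModEq] at h
  rw [Nat.even_iff]
  omega

theorem multisumTerm_eq {ν i m M : ℕ} {s q : ℂ} (hs : s ^ 2 = q) (hν : 0 < ν + 1)
    (n : Fin (ν + 1) → ℕ) (h : ParityCondition i m n) :
    multisumTerm hν M q i m n =
      (s ^ 3) ^ (i ^ 2) * qBinomial (q ^ 3) M i * innerTerm ν s q i m n := by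
  rw [innerTerm, if_pos (parityCondition_iff.mp h), multisumTerm]
  have e : q ^ ((m ^ 2 + 3 * (i ^ 2 + ∑ k, tailSum n k ^ 2)) / 2) =
      (s ^ 3) ^ (i ^ 2) * s ^ (m ^ 2 + 3 * ∑ k, tailSum n k ^ 2) := by
    rw [← hs, ← pow_mul, Nat.mul_div_cancel' (exponent_even h).two_dvd, ← pow_mul, ← pow_add]
    congr 1
    ring
  rw [e]
  ring

theorem finsum_multisum_eq {ν M : ℕ} {s q : ℂ} (hs : s ^ 2 = q) (hq : ‖q‖ < 1) (hq0 : q ≠ 0)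
    (hν : 0 < ν + 1) :
    ∑ᶠ x ∈ multisumIndex (ν + 1), multisumTerm hν M q x.1 x.2.1 x.2.2 =
      ∑ᶠ j : ℤ, singleSumTerm (ν + 1) M q j := by
  classical
  have ht : (s ^ 3) ^ 2 = q ^ 3 := by rw [← hs]; ring
  have h1 : ∀ x : ℕ × ℕ × (Fin (ν + 1) → ℕ),
      (∑ᶠ _ : x ∈ multisumIndex (ν + 1), multisumTerm hν M q x.1 x.2.1 x.2.2) =
      (s ^ 3) ^ (x.1 ^ 2) * qBinomial (q ^ 3) M x.1 * innerTerm ν s q x.1 x.2.1 x.2.2 := by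
    intro x
    rw [finsum_eq_if]
    split_ifs with h
    · exact multisumTerm_eq hs hν x.2.2 h
    · rw [innerTerm, if_neg (fun h2 => h (parityCondition_iff.mpr h2)), mul_zero]
  simp_rw [h1]
  rw [finsum_curry]
  swap
  · refine finite_of_nat_bounds₂ M fun x hx => ?_
    have h2 := qBinomial_bounds (right_ne_zero_of_mul (left_ne_zero_of_mul hx))
    have h3 := innerTerm_bounds (right_ne_zero_of_mul hx)
    refine ⟨?_, ?_, fun k => ?_⟩
    · omega
    · omega
    · have := h3.2.2 k
      omega
  have h2 : ∀ i : ℕ, ∑ᶠ x : ℕ × (Fin (ν + 1) → ℕ),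
      (s ^ 3) ^ (i ^ 2) * qBinomial (q ^ 3) M i * innerTerm ν s q i x.1 x.2 =
      (fun i : ℤ => (s ^ 3) ^ (i ^ 2) * qBinomial (q ^ 3) M i *
        ∑ᶠ N : ℤ, (s ^ 3) ^ (N ^ 2) * trinSum (s ^ 3) (q ^ 3) q (ν + 1) (i - N) N) (i : ℤ) := by
    intro i
    have h3 := finsum_fiber (fun x : ℕ × (Fin (ν + 1) → ℕ) => tailSum x.2 0)
      (fun x => innerTerm ν s q i x.1 x.2) (fun _ => 1) (innerTerm_finite ν s q i)
    have h4 : ∀ N : ℕ, (∑ᶠ x : ℕ × (Fin (ν + 1) → ℕ),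
        if tailSum x.2 0 = N then innerTerm ν s q i x.1 x.2 else 0) = layer ν s q i N :=
      fun N => rfl
    simp_rw [h4, one_mul, layer_eq hs hq hq0] at h3
    rw [← mul_finsum, h3]
    dsimp only
    rw [← finsum_natCast]
    · have e : (s ^ 3) ^ ((i : ℤ) ^ 2) = (s ^ 3) ^ (i ^ 2) := by norm_cast
      rw [e]
      congr 1
    · intro n hn
      obtain ⟨b, hb⟩ := exists_ne_zero_of_finsum (right_ne_zero_of_mul hn)
      exact (trin_bounds (right_ne_zero_of_mul hb)).2.1
  simp_rw [h2]
  rw [finsum_natCast (fun i : ℤ => (s ^ 3) ^ (i ^ 2) * qBinomial (q ^ 3) M i *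
    ∑ᶠ N : ℤ, (s ^ 3) ^ (N ^ 2) * trinSum (s ^ 3) (q ^ 3) q (ν + 1) (i - N) N),
    trinSum_total ht (norm_cube_lt_one hq) (pow_ne_zero 3 hq0) (by omega)]
  · refine finsum_congr fun j => ?_
    unfold singleSumTerm
    -- With c = ν + 1 this gives t^((c+1)(c+2)) = s^(6 · choose(c+2, 2)) = q^(3 · choose(c+2, 2)).
    have hc : 2 * ((ν + 1 + 2).choose 2 : ℤ) = (ν + 3) * (ν + 2) := by
      have h3 : (ν + 1 + 2).choose 2 * 2 = (ν + 3) * (ν + 2) := by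
        rw [Nat.choose_two_right]
        exact Nat.div_mul_cancel (Nat.even_mul_pred_self _).two_dvd
      have h4 : (((ν + 1 + 2).choose 2 * 2 : ℕ) : ℤ) = ((ν + 3) * (ν + 2) : ℕ) := by rw [h3]
      push_cast at h4
      linarith
    have e : (s ^ 3) ^ (((ν : ℤ) + 1 + 1) * (ν + 1 + 2) * j ^ 2) =
        q ^ (3 * ((ν + 1 + 2).choose 2 : ℤ) * j ^ 2) := by
      rw [zpow_of_sq hs, ← zpow_natCast, ← zpow_mul]
      congr 1
      push_cast
      linear_combination (-3 * j ^ 2) * hc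
    rw [zpow_add₀ hq0, e]
    push_cast
    ring
  · intro i hi
    exact (qBinomial_bounds (right_ne_zero_of_mul (left_ne_zero_of_mul hi))).1

/-! ### Finiteness of the two supports. -/

theorem multisumTerm_bounds {ν i m M : ℕ} {q : ℂ} (hν : 0 < ν) {n : Fin ν → ℕ}
    (h : multisumTerm hν M q i m n ≠ 0) : i ≤ M ∧ m ≤ M ∧ ∀ k, n k ≤ M := by
  unfold multisumTerm at h
  have h1 := qBinomial_bounds (right_ne_zero_of_mul (left_ne_zero_of_mul h))
  have h2 := qBinomial_bounds (right_ne_zero_of_mul (left_ne_zero_of_mul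
    (left_ne_zero_of_mul (left_ne_zero_of_mul h))))
  have h3 : ∀ k, (tailSum n k : ℤ) ≤ ∑ k, (tailSum n k : ℤ) := fun k =>
    Finset.single_le_sum (f := fun k => (tailSum n k : ℤ)) (fun _ _ => Int.natCast_nonneg _)
      (Finset.mem_univ k)
  have h4 := h3 ⟨0, hν⟩
  refine ⟨by omega, by omega, fun k => ?_⟩
  have := h3 k
  have := le_tailSum n k
  omega

theorem multisumTerm_finite {ν : ℕ} (hν : 0 < ν) (M : ℕ) (q : ℂ) :
    {p ∈ multisumIndex ν | multisumTerm hν M q p.1 p.2.1 p.2.2 ≠ 0}.Finite :=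
  (finite_of_nat_bounds₂ M fun _ hx => multisumTerm_bounds hν hx).subset fun _ hx => hx.2

theorem singleSumTerm_finite (ν M : ℕ) (q : ℂ) : {j : ℤ | singleSumTerm ν M q j ≠ 0}.Finite := by
  refine finite_of_int_bounds (-M) M fun j hj => ?_
  have h := qBinomial_bounds (right_ne_zero_of_mul hj)
  constructor <;> nlinarith

/-! ### The case `q = 0` -/

theorem qBinomial_self_zero (p : ℂ) : qBinomial p 0 0 = 1 := by simp [qBinomial_eq]

theorem qFac_base_zero (n : ℤ) : qFac 0 n = 1 := by simp [qFac, qPochhammer]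

theorem qBinomial_base_zero {A B : ℤ} (hB : 0 ≤ B) (hA : B ≤ A) : qBinomial 0 A B = 1 := by
  simp [qBinomial_eq, qInvFac, qFac_base_zero, hB, hA]

theorem multisumTerm_base_zero_origin {ν : ℕ} (hν : 0 < ν) (M : ℕ) :
    multisumTerm hν M 0 0 0 0 = 1 := by
  have h : ∀ k, tailSum (0 : Fin ν → ℕ) k = 0 := fun k => by simp [tailSum]
  simp [multisumTerm, h, lastEntry, qBinomial_self_zero, qBinomial_base_zero]

theorem multisumTerm_base_zero_ne {ν i m M : ℕ} (hν : 0 < ν) {n : Fin ν → ℕ}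
    (hp : ParityCondition i m n) (h : multisumTerm hν M 0 i m n ≠ 0) : i = 0 ∧ m = 0 ∧ n = 0 := by
  unfold multisumTerm at h
  have h1 : (m ^ 2 + 3 * (i ^ 2 + ∑ k, tailSum n k ^ 2)) / 2 = 0 := by
    by_contra h2
    exact h (by simp [h2])
  -- The halved exponent being 0 allows the exponent to be 0 or 1; evenness rules out 1.
  obtain ⟨c, hc⟩ := exponent_even hp
  have hm : m ^ 2 = 0 := by omega
  have hi : i ^ 2 = 0 := by omega
  have hN : ∑ k, tailSum n k ^ 2 = 0 := by omega
  refine ⟨by simpa using hi, by simpa using hm, funext fun k => ?_⟩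
  have h3 : tailSum n k ^ 2 = 0 := Finset.sum_eq_zero_iff.mp hN k (Finset.mem_univ k)
  have h4 : tailSum n k = 0 := by simpa using h3
  have := le_tailSum n k
  rw [Pi.zero_apply]
  omega

theorem singleSumTerm_base_zero (ν M : ℕ) (j : ℤ) :
    singleSumTerm ν M 0 j = if j = 0 then 1 else 0 := by
  unfold singleSumTerm
  split_ifs with hj
  · subst hj
    simp [qBinomial_base_zero (A := 2 * M) (B := M) (by omega) (by omega)]
  · have hc : 1 ≤ ((ν + 2).choose 2 : ℤ) := by
      exact_mod_cast Nat.choose_pos (by omega)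
    have he : 3 * ((ν + 2).choose 2 : ℤ) * j ^ 2 + j ≠ 0 := by
      have h1 : 1 ≤ j ^ 2 := by have := sq_pos_of_ne_zero hj; omega
      have h2 : -j ≤ j ^ 2 := by nlinarith [sq_nonneg (j + 1), Int.le_self_sq (-j)]
      nlinarith
    rw [zero_zpow _ he, zero_mul]

theorem finsum_multisum_base_zero {ν : ℕ} (hν : 0 < ν) (M : ℕ) :
    ∑ᶠ x ∈ multisumIndex ν, multisumTerm hν M 0 x.1 x.2.1 x.2.2 =
      ∑ᶠ j : ℤ, singleSumTerm ν M 0 j := by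
  classical
  simp_rw [singleSumTerm_base_zero]
  rw [finsum_eq_single _ 0 fun j hj => if_neg hj, if_pos rfl,
    finsum_eq_single _ ((0, 0, 0) : ℕ × ℕ × (Fin ν → ℕ))]
  · have h : ((0, 0, 0) : ℕ × ℕ × (Fin ν → ℕ)) ∈ multisumIndex ν := by
      simp [multisumIndex, ParityCondition, tailSum]
      rfl
    rw [finsum_eq_if, if_pos h]
    exact multisumTerm_base_zero_origin hν M
  · rintro ⟨i, m, n⟩ hx
    rw [finsum_eq_if]
    split_ifs with h
    · by_contra h2
      obtain ⟨rfl, rfl, rfl⟩ := multisumTerm_base_zero_ne hν h h2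
      exact hx rfl
    · rfl

end QSeries

theorem mainTheorem10 (ν : ℕ) (hν : 0 < ν) (M : ℕ) (q : ℂ) (hq : ‖q‖ < 1) :
    {p ∈ QSeries.multisumIndex ν |
        QSeries.multisumTerm hν M q p.1 p.2.1 p.2.2 ≠ 0}.Finite ∧
    {j : ℤ | QSeries.singleSumTerm ν M q j ≠ 0}.Finite ∧
    ∑ᶠ p ∈ QSeries.multisumIndex ν, QSeries.multisumTerm hν M q p.1 p.2.1 p.2.2 =
      ∑ᶠ j : ℤ, QSeries.singleSumTerm ν M q j := by
  refine ⟨QSeries.multisumTerm_finite hν M q, QSeries.singleSumTerm_finite ν M q, ?_⟩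
  rcases eq_or_ne q 0 with rfl | hq0
  · exact QSeries.finsum_multisum_base_zero hν M
  · obtain ⟨ν, rfl⟩ := Nat.exists_eq_succ_of_ne_zero hν.ne'
    obtain ⟨s, hs⟩ := IsAlgClosed.exists_pow_nat_eq q two_pos
    exact QSeries.finsum_multisum_eq hs hq hq0 hν
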